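/- Let $k$ be an infinite field, let $n,r,d$ be positive integers, and assume that $\operatorname{char} k=0$ or $\operatorname{char} k>n$. Let $P(i)$ be the number of partitions of $i$, and assume $$n\ \ge\ \max\Bigl\{d+1,\ 1+\frac1r\sum_{i=0}^{d-1}P(i)\Bigr\}.$$ Let $R=k[x_1,\dots,x_n]$, on which $\mathfrak S_n$ acts by permuting the variables, with invariant ring $R'=R^{\mathfrak S_n}$ and Reynolds operator $\rho(f)=\frac1{n!}\sum_{\sigma}\sigma\cdot f$. For a subspace $V\subseteq R_d$ let $(V)_{\mathfrak S_n}=(\sigma\cdot f:\sigma\in\mathfrak S_n,\ f\in V)$ and $\alpha(V)=\rho(V)$. An ideal of $R$ is an *$(r,d)$-symmetric ideal* if it equals $(V)_{\mathfrak S_n}$ for some $V\in\mathrm{Gr}(r,R_d)$, the Grassmannian of $r$-dimensional subspaces of $R_d$. Let $S$ be the divided power algebra over $k$ on $y_1,\dots,y_n$, in degrees $\deg y_i=-1$, on which $R$ acts by contraction $\circ$ and $\mathfrak S_n$ by permuting the variables; put $S'=S^{\mathfrak S_n}$. For $U\subseteq R'_d$ let $U^\perp=\{w\in S'_{-d}: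 u\circ w=0\text{ for all }u\in U\}$. For a subspace $W\subseteq S'_{-d}$ with basis $F_1,\dots,F_a$, let $L_W$ be the space of all $(\ell_1,\dots,\ell_a)\in R_1^a$ with $\sum_j\ell_j\circ F_j=0$. Let $G$ be the set of all $U\in\mathrm{Gr}(r,R'_d)$ such that $W=U^\perp$ satisfies: (i) if $F\in W$ and $(x_1-x_2)\circ F=0$, then $F=0$; (ii) for every $(\ell_1,\dots,\ell_a)\in L_W$, each $\ell_j$ is a scalar multiple of $x_1+\dots+x_n$; (iii) $\dim_k L_W=\max\{P(d)-P(d-1)-r,0\}$. Let $$\widetilde O=\{V\in\mathrm{Gr}(r,R_d):\dim_k[(V)_{\mathfrak S_n}]_d\ge\dim_kR_d-\max\{P(d)-r,0\}\},$$ and let $O=\{V\in\widetilde O:\alpha(V)\in G\}$ if $r<P(d)$, and $O=\widetilde O$ if $r\ge P(d)$. A *general $(r,d)$-symmetric ideal* is an ideal of the form $(V)_{\mathfrak S_n}$ with $V\in O$. Then $O$ is a Zariski open subset of $\mathrm{Gr}(r,R_d)$, it is nonempty whenever $r\le\dim_kR_d=\binom{n+d-1}{d}$, and if $I$ is a general $(r,d)$-symmetric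 ideal and $J$ is any $(r,d)$-symmetric ideal, then $$\dim_k(R/I)_i\le\dim_k(R/J)_i\qquad\text{for all }i.$$ -/

import Mathlib

/-! Throughout, `R = k[x_1, …, x_n]` is `MvPolynomial (Fin n) k`, with the permutation `σ` acting by
`x_i ↦ x_{σ i}`, that is, by `MvPolynomial.rename σ`. -/

open MvPolynomial

noncomputable section

namespace SymIdeal

/-- `P(d)`, the number of partitions of `d`. -/
def P (d : ℕ) : ℕ := Fintype.card (Nat.Partition d)

/-- `R_d`, the space of forms of degree `d`. -/
abbrev forms (k : Type*) [Field k] (n d : ℕ) : Submodule k (MvPolynomial (Fin n) k) :=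
  homogeneousSubmodule (Fin n) k d

/-- `R'_d`, the space of symmetric forms of degree `d`. -/
def invForms (k : Type*) [Field k] (n d : ℕ) : Submodule k (MvPolynomial (Fin n) k) :=
  (symmetricSubalgebra (Fin n) k).toSubmodule ⊓ forms k n d

/-- The Grassmannian `Gr(r, M)` of `r`-dimensional subspaces of a subspace `M` of `R`. -/
def Gr {k : Type*} [Field k] {n : ℕ} (r : ℕ) (M : Submodule k (MvPolynomial (Fin n) k)) :
    Set (Submodule k (MvPolynomial (Fin n) k)) :=
  {V | V ≤ M ∧ Module.finrank k V = r}

/-- `O` is an open subset of `Gr(r, M)` for the Zariski topology. The Grassmannian is the quotient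
of the space of linearly independent `r`-tuples in `M` by change of basis, so this says that the
set of the linearly independent `r`-tuples `v` in `M` whose span lies in `O` is the locus where not
all members of some set `F` of polynomials in the coefficients of `v_1, …, v_r` vanish. -/
def IsZariskiOpen {k : Type*} [Field k] {n : ℕ} (r : ℕ)
    (M : Submodule k (MvPolynomial (Fin n) k))
    (O : Set (Submodule k (MvPolynomial (Fin n) k))) : Prop :=
  O ⊆ Gr r M ∧
    ∃ F : Set (MvPolynomial (Fin r × (Fin n →₀ ℕ)) k),
      ∀ v : Fin r → MvPolynomial (Fin n) k, (∀ j, v j ∈ M) → LinearIndependent k v →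
        (Submodule.span k (Set.range v) ∈ O ↔
          ∃ p ∈ F, eval (fun ja => coeff ja.2 (v ja.1)) p ≠ 0)

/-- `(V)_{𝔖_n}`, the ideal generated by the orbits of the elements of `V`. -/
def symSpan {k : Type*} [Field k] {n : ℕ} (V : Submodule k (MvPolynomial (Fin n) k)) :
    Ideal (MvPolynomial (Fin n) k) :=
  Ideal.span {g | ∃ σ : Equiv.Perm (Fin n), ∃ f ∈ V, g = rename σ f}

/-- `J` is an `(r,d)`-symmetric ideal. -/
def IsSymmetricIdeal {k : Type*} [Field k] {n : ℕ} (r d : ℕ)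
    (J : Ideal (MvPolynomial (Fin n) k)) : Prop :=
  ∃ V ∈ Gr r (forms k n d), J = symSpan V

/-- The Hilbert function of `R/I` for a homogeneous ideal `I`: the dimension of `(R/I)_i`, which is
the image of `R_i` in `R/I`. -/
def hilbertFunction {k : Type*} [Field k] {n : ℕ} (I : Ideal (MvPolynomial (Fin n) k)) (i : ℕ) :
    ℕ :=
  Module.finrank k ((forms k n i).map (Ideal.Quotient.mkₐ k I).toLinearMap)

/-- The Reynolds operator `ρ(f) = (1 / n!) ∑_σ σ · f`. -/
def reynolds (k : Type*) [Field k] (n : ℕ) :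
    MvPolynomial (Fin n) k →ₗ[k] MvPolynomial (Fin n) k :=
  ((n.factorial : k)⁻¹) • ∑ σ : Equiv.Perm (Fin n), (rename (R := k) σ).toLinearMap

/-- `α(V)`, the span of the elements `ρ(f)` with `f ∈ V`. -/
def alpha {k : Type*} [Field k] {n : ℕ} (V : Submodule k (MvPolynomial (Fin n) k)) :
    Submodule k (MvPolynomial (Fin n) k) :=
  V.map (reynolds k n)

/-- The underlying vector space of the divided power algebra `S` on `y_1, …, y_n`; the basis vector
indexed by `e` is the divided monomial `y_1^(e_1) ⋯ y_n^(e_n)`, of degree `-(e_1 + ⋯ + e_n)`. -/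
abbrev DP (k : Type*) [Field k] (n : ℕ) : Type _ := (Fin n →₀ ℕ) →₀ k

/-- Contraction `f ∘ g` of `g ∈ S` by `f ∈ R`: the coefficient of `x^a ∘ g` at `e` is the
coefficient of `g` at `e + a`; in other words `x^a ∘ y^(b)` is `y^(b-a)` if `a ≤ b`, and `0`
otherwise. -/
def contract (k : Type*) [Field k] (n : ℕ) :
    MvPolynomial (Fin n) k →ₗ[k] DP k n →ₗ[k] DP k n :=
  (basisMonomials (Fin n) k).constr k
    (fun a => Finsupp.lcomapDomain (fun e : Fin n →₀ ℕ => e + a) (add_left_injective a))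

/-- `S'_{-d}`, the space of elements of `S` of degree `-d` that are invariant under the action
`y_i ↦ y_{σ i}`. -/
def invDP (k : Type*) [Field k] (n d : ℕ) : Submodule k (DP k n) :=
  Finsupp.supported k k {e : Fin n →₀ ℕ | e.degree = d} ⊓
    ⨅ σ : Equiv.Perm (Fin n),
      LinearMap.eqLocus (Finsupp.lmapDomain k k (Finsupp.mapDomain (M := ℕ) σ)) LinearMap.id

/-- `U^⊥`, the space of those `w ∈ S'_{-d}` with `u ∘ w = 0` for all `u ∈ U`. -/
def perp {k : Type*} [Field k] {n : ℕ} (d : ℕ) (U : Submodule k (MvPolynomial (Fin n) k)) :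
    Submodule k (DP k n) :=
  invDP k n d ⊓ ⨅ u ∈ U, LinearMap.ker (contract k n u)

/-- `L_W`, the space of linear syzygies on `W`. A basis `F_1, …, F_a` of `W` identifies the tuples of
linear forms `(∑_i c_{ij} x_i)_j` with the families `w_i = ∑_j c_{ij} F_j` in `W`, and the relation
`∑_j (∑_i c_{ij} x_i) ∘ F_j = 0` becomes `∑_i x_i ∘ w_i = 0`. -/
def linSyz {k : Type*} [Field k] {n : ℕ} (W : Submodule k (DP k n)) : Submodule k (Fin n → W) :=
  LinearMap.ker (∑ i, contract k n (X i) ∘ₗ W.subtype ∘ₗ LinearMap.proj i)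

/-- All linear syzygies on `W` have coefficients with `c_{ij} = c_{i'j}` for all `i, i', j`. -/
def PropP {k : Type*} [Field k] {n : ℕ} (W : Submodule k (DP k n)) : Prop :=
  ∀ w ∈ linSyz W, ∀ i i' : Fin n, w i = w i'

/-- For `F ∈ W`, if `(x_1 - x_2) ∘ F = 0` then `F = 0`. (The indices in `Fin n` start at `0`.) -/
def PropQ {k : Type*} [Field k] {n : ℕ} (W : Submodule k (DP k n)) : Prop :=
  ∀ i j : Fin n, (i : ℕ) = 0 → (j : ℕ) = 1 →
    ∀ F ∈ W, contract k n (X i - X j) F = 0 → F = 0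

/-- The open subset `G` of `Gr(r, R'_d)`: it consists of the `U` for which `W = U^⊥` satisfies both
properties above and `dim L_W = max (P(d) - P(d-1) - r, 0)`. -/
def G (k : Type*) [Field k] (n r d : ℕ) : Set (Submodule k (MvPolynomial (Fin n) k)) :=
  {U | U ∈ Gr r (invForms k n d) ∧ PropQ (perp d U) ∧ PropP (perp d U) ∧
    Module.finrank k (linSyz (perp d U)) = P d - P (d - 1) - r}

/-- The set of the `V ∈ Gr(r, R_d)` with
`dim [(V)_{𝔖_n}]_d ≥ dim R_d - max (P(d) - r, 0)`. -/
def OTilde (k : Type*) [Field k] (n r d : ℕ) : Set (Submodule k (MvPolynomial (Fin n) k)) :=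
  {V | V ∈ Gr r (forms k n d) ∧
    Module.finrank k (forms k n d) ≤
      Module.finrank k ((symSpan V).restrictScalars k ⊓ forms k n d :
        Submodule k (MvPolynomial (Fin n) k)) + (P d - r)}

/-- The open subset `O` of `Gr(r, R_d)`: it is `OTilde ∩ α⁻¹(G)` if `r < P(d)`, and `OTilde`
otherwise. -/
def O (k : Type*) [Field k] (n r d : ℕ) : Set (Submodule k (MvPolynomial (Fin n) k)) :=
  {V | V ∈ OTilde k n r d ∧ (r < P d → alpha V ∈ G k n r d)}

/-- `I` is a general `(r,d)`-symmetric ideal. -/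
def IsGeneralSymmetricIdeal {k : Type*} [Field k] {n : ℕ} (r d : ℕ)
    (I : Ideal (MvPolynomial (Fin n) k)) : Prop :=
  ∃ V ∈ O k n r d, I = symSpan V

end SymIdeal

end

/-! ### The Reynolds operator and coefficient sums -/

noncomputable section

namespace SymIdeal

/-! Let `I = symSpan V`. Its degree `d` part `K` is the span of the orbits of `V` (`orbitSpan`). The
Reynolds operator `ρ` is constant on orbits, so `ρ(K) = α(V)` has dimension at most `r`, whereas
`ρ(R_d) = R'_d` has dimension `P d`, as `d ≤ n`. Hence `dim K ≤ dim R_d - max (P d - r, 0)`, and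
`OTilde` is the locus of equality.

Minimality. Below degree `d` the ideal is zero, and in degree `d` the bound is attained. If `r ≥ P
d`, then `K = R_d`. If `r < P d`, then `K` contains `R_d ∩ ker ρ`, so monomials of degree `d` in one
orbit agree modulo `I`. Multiplication by variables then identifies all `x_i x^b` with `i` fixed,
and an element of `α(V)` with nonzero coefficient sum kills them: `I` contains `R_{d+1}`
(`forms_succ_le`).

Openness. Property (i) of `U^⊥` says that some element of `U` has nonzero coefficient sum; it
implies (ii); and then `L_W` is the orthogonal space of `U + e_1 R'_{d-1}`, where `e_1` is the sum
of the variables. So `G` is cut out by a rank bound and the nonvanishing of a linear form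
(`mem_G_iff`), and rank bounds are nonvanishing of minors.

Nonemptiness. A `U` in `G` is found by linear algebra. To lift it to `V` with `R_d ∩ ker ρ ⊆ K`,
average over the chain of subgroups fixing the first `q` indices. Differences of consecutive
averages are orthogonal idempotents, so each of the `r` generators carries `n - 1` independently
chosen components, each of which lies in `K`. One component is spent on each descent of each sorted
exponent vector of degree `d`. There are at most `P 0 + ⋯ + P (d - 1) ≤ r (n - 1)` descents, and
Hall's theorem allocates them (`exists_allocation`, `exists_generators`). -/

theorem mem_forms {k : Type*} [Field k] {n d : ℕ} {f : MvPolynomial (Fin n) k} :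
    f ∈ forms k n d ↔ f.IsHomogeneous d := mem_homogeneousSubmodule d f

theorem mem_invForms {k : Type*} [Field k] {n d : ℕ} {f : MvPolynomial (Fin n) k} :
    f ∈ invForms k n d ↔ (∀ σ : Equiv.Perm (Fin n), rename σ f = f) ∧ f ∈ forms k n d := by
  rfl

theorem invForms_le_forms (k : Type*) [Field k] (n d : ℕ) : invForms k n d ≤ forms k n d :=
  inf_le_right

/-- A prime divides `n!` only if it is at most `n`. This makes all averages over subgroups of `𝔖_n`
available. -/
theorem factorial_ne_zero_of_char {k : Type*} [Field k] {n : ℕ}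
    (hchar : ringChar k = 0 ∨ n < ringChar k) : (n.factorial : k) ≠ 0 := by
  intro h
  have h1 := (ringChar.spec k n.factorial).1 h
  rcases hchar with h0 | hlt
  · rw [h0, zero_dvd_iff] at h1
    exact n.factorial_ne_zero h1
  · have hp : (ringChar k).Prime :=
      (CharP.char_is_prime_or_zero k (ringChar k)).resolve_right (by omega)
    exact absurd ((hp.dvd_factorial).1 h1) (by omega)

theorem natCast_ne_zero_of_dvd_factorial {k : Type*} [Field k] {n m : ℕ}
    (hf : (n.factorial : k) ≠ 0) (hm : m ∣ n.factorial) : (m : k) ≠ 0 := by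
  rintro h
  obtain ⟨c, hc⟩ := hm
  exact hf (by rw [hc, Nat.cast_mul, h, zero_mul])

instance forms_finiteDimensional (k : Type*) [Field k] (n d : ℕ) :
    FiniteDimensional k (forms k n d) := by
  have hs : forms k n d ≤ Submodule.span k
      ((fun a => monomial a (1 : k)) '' {a : Fin n →₀ ℕ | a.degree = d}) := by
    intro f hf
    rw [f.as_sum]
    refine Submodule.sum_mem _ fun a ha => ?_
    have : monomial a (coeff a f) = coeff a f • monomial a (1 : k) := by
      rw [smul_monomial, smul_eq_mul, mul_one]
    rw [this]
    refine Submodule.smul_mem _ _ (Submodule.subset_span ⟨a, ?_, rfl⟩)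
    by_contra hne
    exact (mem_support_iff.1 ha) (IsHomogeneous.coeff_eq_zero (mem_forms.1 hf) hne)
  have := FiniteDimensional.span_of_finite k
    ((Finsupp.finite_of_degree_eq (σ := Fin n) d).image fun a => monomial a (1 : k))
  exact Submodule.finiteDimensional_of_le hs

instance invForms_finiteDimensional (k : Type*) [Field k] (n d : ℕ) :
    FiniteDimensional k (invForms k n d) :=
  Submodule.finiteDimensional_of_le (invForms_le_forms k n d)

theorem rename_mem_forms {k : Type*} [Field k] {n d : ℕ} {f : MvPolynomial (Fin n) k}
    (hf : f ∈ forms k n d) (σ : Equiv.Perm (Fin n)) : rename σ f ∈ forms k n d :=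
  (mem_forms.1 hf).rename_isHomogeneous

theorem rename_mul_perm {k : Type*} [Field k] {n : ℕ} (σ τ : Equiv.Perm (Fin n))
    (f : MvPolynomial (Fin n) k) : rename (σ * τ) f = rename σ (rename τ f) := by
  rw [rename_rename]; rfl

theorem rename_one_perm {k : Type*} [Field k] {n : ℕ} (f : MvPolynomial (Fin n) k) :
    rename (1 : Equiv.Perm (Fin n)) f = f := by
  simp

theorem reynolds_apply {k : Type*} [Field k] {n : ℕ} (f : MvPolynomial (Fin n) k) :
    reynolds k n f = (n.factorial : k)⁻¹ • ∑ σ : Equiv.Perm (Fin n), rename σ f := by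
  simp [reynolds]

theorem rename_reynolds {k : Type*} [Field k] {n : ℕ} (σ : Equiv.Perm (Fin n))
    (f : MvPolynomial (Fin n) k) : rename σ (reynolds k n f) = reynolds k n f := by
  rw [reynolds_apply, map_smul, map_sum]
  congr 1
  exact Fintype.sum_equiv (Equiv.mulLeft σ) _ _ fun τ => (rename_mul_perm σ τ f).symm

theorem reynolds_rename {k : Type*} [Field k] {n : ℕ} (σ : Equiv.Perm (Fin n))
    (f : MvPolynomial (Fin n) k) : reynolds k n (rename σ f) = reynolds k n f := by
  rw [reynolds_apply, reynolds_apply]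
  congr 1
  exact Fintype.sum_equiv (Equiv.mulRight σ) _ _ fun τ => (rename_mul_perm τ σ f).symm

theorem reynolds_mem_forms {k : Type*} [Field k] {n d : ℕ} {f : MvPolynomial (Fin n) k}
    (hf : f ∈ forms k n d) : reynolds k n f ∈ forms k n d := by
  rw [reynolds_apply]
  exact Submodule.smul_mem _ _ (Submodule.sum_mem _ fun σ _ => rename_mem_forms hf σ)

theorem reynolds_mem_invForms {k : Type*} [Field k] {n d : ℕ} {f : MvPolynomial (Fin n) k}
    (hf : f ∈ forms k n d) : reynolds k n f ∈ invForms k n d :=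
  mem_invForms.2 ⟨fun σ => rename_reynolds σ f, reynolds_mem_forms hf⟩

theorem reynolds_eq_self {k : Type*} [Field k] {n d : ℕ} (hf : (n.factorial : k) ≠ 0)
    {f : MvPolynomial (Fin n) k} (h : f ∈ invForms k n d) : reynolds k n f = f := by
  rw [reynolds_apply, Finset.sum_congr rfl fun σ _ => (mem_invForms.1 h).1 σ, Finset.sum_const,
    Finset.card_univ, Fintype.card_perm, Fintype.card_fin, ← Nat.cast_smul_eq_nsmul k, smul_smul,
    inv_mul_cancel₀ hf, one_smul]

/-- The sum of the coefficients of a polynomial. -/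
def coeffSum (k : Type*) [Field k] (n : ℕ) : MvPolynomial (Fin n) k →ₗ[k] k :=
  (aeval (fun _ => (1 : k))).toLinearMap

theorem coeffSum_rename {k : Type*} [Field k] {n : ℕ} (σ : Equiv.Perm (Fin n))
    (f : MvPolynomial (Fin n) k) : coeffSum k n (rename σ f) = coeffSum k n f := by
  simp only [coeffSum, AlgHom.toLinearMap_apply, aeval_rename]
  rfl

theorem coeffSum_monomial {k : Type*} [Field k] {n : ℕ} (a : Fin n →₀ ℕ) (c : k) :
    coeffSum k n (monomial a c) = c := by
  simp [coeffSum, aeval_monomial]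

/-- The coefficient sum is the value at `(1, …, 1)`, which permutations fix. Thus a condition on
coefficient sums in `α(V)` can be read off from `V`. -/
theorem coeffSum_reynolds {k : Type*} [Field k] {n : ℕ} (hf : (n.factorial : k) ≠ 0)
    (f : MvPolynomial (Fin n) k) : coeffSum k n (reynolds k n f) = coeffSum k n f := by
  rw [reynolds_apply, map_smul, map_sum, Finset.sum_congr rfl fun σ _ => coeffSum_rename σ f,
    Finset.sum_const, Finset.card_univ, Fintype.card_perm, Fintype.card_fin,
    ← Nat.cast_smul_eq_nsmul k, smul_smul, inv_mul_cancel₀ hf, one_smul]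

end SymIdeal

end

/-! ### Symmetric forms and partitions -/

noncomputable section

namespace SymIdeal

/-- The antitone exponent vectors of degree `d`. -/
abbrev SortedExp (n d : ℕ) : Type := {a : Fin n →₀ ℕ // Antitone a ∧ a.degree = d}

instance (n d : ℕ) : Finite (SortedExp n d) :=
  Set.Finite.subset (Finsupp.finite_of_degree_eq (σ := Fin n) d) fun _ h => h.2

instance (n d : ℕ) : Fintype (SortedExp n d) := Fintype.ofFinite _

theorem mapDomain_perm_apply {M : Type*} [AddCommMonoid M] {n : ℕ} (σ : Equiv.Perm (Fin n))
    (a : Fin n →₀ M) (i : Fin n) : a.mapDomain σ i = a (σ⁻¹ i) :=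
  Finsupp.mapDomain_equiv_apply a i

theorem mapDomain_mul_perm {M : Type*} [AddCommMonoid M] {n : ℕ} (σ τ : Equiv.Perm (Fin n))
    (a : Fin n →₀ M) : a.mapDomain (σ * τ) = (a.mapDomain τ).mapDomain σ := by
  rw [← Finsupp.mapDomain_comp]; rfl

theorem exists_antitone_mapDomain {n : ℕ} (a : Fin n →₀ ℕ) :
    ∃ σ : Equiv.Perm (Fin n), Antitone (a.mapDomain σ) := by
  refine ⟨(Tuple.sort (fun i => OrderDual.toDual (a i)))⁻¹, fun i j hij => ?_⟩
  have := Tuple.monotone_sort (fun i => OrderDual.toDual (a i)) hij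
  simpa [mapDomain_perm_apply] using this

theorem mapDomain_eq_of_antitone {n : ℕ} {a b : Fin n →₀ ℕ} (ha : Antitone a) (hb : Antitone b)
    (σ : Equiv.Perm (Fin n)) (h : a.mapDomain σ = b) : a = b := by
  have h1 : (b : Fin n → ℕ) = a ∘ (σ⁻¹ : Equiv.Perm (Fin n)) := by
    ext i; rw [← h]; exact mapDomain_perm_apply σ a i
  have := Tuple.unique_antitone (f := a) (σ := 1) (τ := σ⁻¹) ha (h1 ▸ hb)
  ext i
  rw [h1, ← this]; rfl

theorem degree_mapDomain_perm {n : ℕ} (σ : Equiv.Perm (Fin n)) (a : Fin n →₀ ℕ) :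
    (a.mapDomain σ).degree = a.degree := Finsupp.degree_mapDomain _ _

/-- The sorted rearrangement of an exponent vector. -/
def sortExp {n d : ℕ} (a : Fin n →₀ ℕ) (h : a.degree = d) : SortedExp n d :=
  ⟨a.mapDomain (exists_antitone_mapDomain a).choose, (exists_antitone_mapDomain a).choose_spec,
    by rw [degree_mapDomain_perm, h]⟩

theorem exists_mapDomain_sortExp {n d : ℕ} (a : Fin n →₀ ℕ) (h : a.degree = d) :
    ∃ σ : Equiv.Perm (Fin n), a.mapDomain σ = (sortExp a h).1 := ⟨_, rfl⟩

theorem sortExp_mapDomain {n d : ℕ} (a b : Fin n →₀ ℕ) (ha : a.degree = d) (hb : b.degree = d)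
    (σ : Equiv.Perm (Fin n)) (hab : a.mapDomain σ = b) : sortExp a ha = sortExp b hb := by
  obtain ⟨τ, hτ⟩ := exists_mapDomain_sortExp a ha
  obtain ⟨υ, hυ⟩ := exists_mapDomain_sortExp b hb
  apply Subtype.ext
  refine mapDomain_eq_of_antitone (sortExp a ha).2.1 (sortExp b hb).2.1 (υ * σ * τ⁻¹) ?_
  rw [← hτ, ← hυ, ← hab, ← mapDomain_mul_perm, ← mapDomain_mul_perm, inv_mul_cancel_right]

theorem sortExp_coe {n d : ℕ} (a : SortedExp n d) : sortExp a.1 a.2.2 = a := by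
  obtain ⟨τ, hτ⟩ := exists_mapDomain_sortExp a.1 a.2.2
  exact (Subtype.ext (mapDomain_eq_of_antitone a.2.1 (sortExp a.1 a.2.2).2.1 τ hτ)).symm

/-- The exponent vectors of degree `d`. -/
abbrev DegExp (n d : ℕ) : Type := {a : Fin n →₀ ℕ // a.degree = d}

instance (n d : ℕ) : Finite (DegExp n d) := Finsupp.finite_of_degree_eq (σ := Fin n) d

instance (n d : ℕ) : Fintype (DegExp n d) := Fintype.ofFinite _

/-- The symmetric polynomial with prescribed coefficients at the sorted exponents. -/
def symmOfCoeff {k : Type*} [Field k] {n d : ℕ} (c : SortedExp n d → k) :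
    MvPolynomial (Fin n) k :=
  ∑ a : DegExp n d, monomial a.1 (c (sortExp a.1 a.2))

theorem coeff_symmOfCoeff {k : Type*} [Field k] {n d : ℕ} (c : SortedExp n d → k)
    (a : Fin n →₀ ℕ) (h : a.degree = d) : coeff a (symmOfCoeff c) = c (sortExp a h) := by
  classical
  rw [symmOfCoeff, coeff_sum, Finset.sum_eq_single ⟨a, h⟩]
  · simp
  · intro b _ hb
    rw [coeff_monomial, if_neg]
    exact fun e => hb (Subtype.ext e)
  · simp

theorem coeff_symmOfCoeff_of_ne {k : Type*} [Field k] {n d : ℕ} (c : SortedExp n d → k)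
    (a : Fin n →₀ ℕ) (h : a.degree ≠ d) : coeff a (symmOfCoeff c) = 0 := by
  classical
  rw [symmOfCoeff, coeff_sum, Finset.sum_eq_zero]
  intro b _
  rw [coeff_monomial, if_neg]
  rintro rfl
  exact h b.2

theorem symmOfCoeff_mem {k : Type*} [Field k] {n d : ℕ} (c : SortedExp n d → k) :
    symmOfCoeff c ∈ invForms k n d := by
  refine mem_invForms.2 ⟨fun σ => ?_, ?_⟩
  · ext b
    obtain ⟨b', rfl⟩ : ∃ b', Finsupp.mapDomain σ b' = b :=
      ⟨b.mapDomain (σ⁻¹ : Equiv.Perm (Fin n)), by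
        rw [← mapDomain_mul_perm, mul_inv_cancel]; exact Finsupp.mapDomain_id⟩
    rw [coeff_rename_mapDomain _ σ.injective]
    by_cases h : b'.degree = d
    · rw [coeff_symmOfCoeff c b' h, coeff_symmOfCoeff c _ ((degree_mapDomain_perm σ b').trans h)]
      exact congrArg c (sortExp_mapDomain _ _ _ _ σ rfl)
    · rw [coeff_symmOfCoeff_of_ne c b' h, coeff_symmOfCoeff_of_ne c _
        (fun e => h ((degree_mapDomain_perm σ b').symm.trans e))]
  · rw [mem_forms]
    intro b hb
    by_contra hne
    refine hb (coeff_symmOfCoeff_of_ne c b fun h => hne ?_)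
    rw [← h, Finsupp.degree_eq_weight_one]; rfl

theorem coeff_mapDomain_of_symm {k : Type*} [Field k] {n : ℕ} {f : MvPolynomial (Fin n) k}
    (σ : Equiv.Perm (Fin n)) (h : rename σ f = f) (a : Fin n →₀ ℕ) :
    coeff (a.mapDomain σ) f = coeff a f := by
  conv_lhs => rw [← h]
  exact coeff_rename_mapDomain _ σ.injective _ _

/-- Symmetric forms are determined by their coefficients at the sorted exponents. -/
def invFormsEquiv (k : Type*) [Field k] (n d : ℕ) : invForms k n d ≃ₗ[k] (SortedExp n d → k) :=
  LinearEquiv.ofBijective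
    (LinearMap.pi fun a => (lcoeff k a.1) ∘ₗ (invForms k n d).subtype) (by
      constructor
      · rw [← LinearMap.ker_eq_bot, LinearMap.ker_eq_bot']
        rintro ⟨f, hf⟩ h0
        apply Subtype.ext
        ext a
        by_cases h : a.degree = d
        · obtain ⟨σ, hσ⟩ := exists_mapDomain_sortExp a h
          change coeff a f = 0
          rw [← coeff_mapDomain_of_symm σ ((mem_invForms.1 hf).1 σ), hσ]
          exact congrFun h0 (sortExp a h)
        · exact IsHomogeneous.coeff_eq_zero (mem_forms.1 (invForms_le_forms _ _ _ hf)) h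
      · intro c
        refine ⟨⟨symmOfCoeff c, symmOfCoeff_mem c⟩, ?_⟩
        ext a
        change coeff a.1 (symmOfCoeff c) = c a
        rw [coeff_symmOfCoeff c a.1 a.2.2, sortExp_coe])

/-- The partition given by the nonzero entries of an exponent vector. -/
def SortedExp.toPartition {n d : ℕ} (a : SortedExp n d) : Nat.Partition d :=
  Nat.Partition.ofSums d (Finset.univ.val.map a.1)
    (by refine Eq.trans ?_ a.2.2; rw [Finsupp.degree_eq_sum]; rfl)

/-- The cardinality determines how many zeros pad the nonzero elements. -/
theorem multiset_eq_of_filter_eq {A B : Multiset ℕ} (hc : A.card = B.card)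
    (h : A.filter (· ≠ 0) = B.filter (· ≠ 0)) : A = B := by
  have key : ∀ C : Multiset ℕ, C = Multiset.replicate (C.card - (C.filter (· ≠ 0)).card) 0 +
      C.filter (· ≠ 0) := by
    intro C
    have h1 := Multiset.filter_add_not (· = 0) C
    have h2 : C.filter (· = 0) = Multiset.replicate (C.filter (· = 0)).card 0 :=
      Multiset.eq_replicate_card.2 fun b hb => (Multiset.mem_filter.1 hb).2
    have h3 := congrArg Multiset.card h1
    rw [Multiset.card_add] at h3
    have h4 : (C.filter (· = 0)).card = C.card - (C.filter (· ≠ 0)).card := by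
      simp only [ne_eq]; omega
    rw [← h4, ← h2]
    exact h1.symm
  rw [key A, key B, h, hc]

theorem toPartition_injective (n d : ℕ) :
    Function.Injective (SortedExp.toPartition : SortedExp n d → _) := by
  intro a b h
  have h1 := congrArg Nat.Partition.parts h
  have h2 : (Finset.univ.val.map a.1 : Multiset ℕ) = Finset.univ.val.map b.1 :=
    multiset_eq_of_filter_eq (by simp) h1
  rw [Fin.univ_val_map, Fin.univ_val_map, Multiset.coe_eq_coe] at h2
  have h3 := h2.eq_of_pairwise' a.2.1.sortedGE_ofFn.pairwise b.2.1.sortedGE_ofFn.pairwise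
  exact Subtype.ext (DFunLike.coe_injective (List.ofFn_injective h3))

/-- A partition of `d` has at most `d ≤ n` parts, so its decreasing list of parts can be padded with
zeros to length `n`. -/
theorem toPartition_surjective {n d : ℕ} (hdn : d ≤ n) :
    Function.Surjective (SortedExp.toPartition : SortedExp n d → _) := by
  intro μ
  set L := μ.parts.sort (· ≥ ·) with hL
  have hLs : L.Pairwise (· ≥ ·) := Multiset.pairwise_sort _ _
  have hLe : (L : Multiset ℕ) = μ.parts := Multiset.sort_eq _ _
  have hlen : L.length ≤ n := by
    refine le_trans ?_ hdn
    have h1 : L.length = μ.parts.card := by rw [← hLe]; rfl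
    rw [h1]
    have h2 := Multiset.card_nsmul_le_sum (s := μ.parts) (a := 1) fun x hx => μ.parts_pos hx
    rw [μ.parts_sum] at h2
    simpa using h2
  let f : Fin n → ℕ := fun i => L.getD i 0
  have hf : List.ofFn f = L ++ List.replicate (n - L.length) 0 := by
    apply List.ext_getElem
    · simp; omega
    · intro i h1 h2
      simp only [List.getElem_ofFn, f]
      by_cases h : i < L.length
      · rw [List.getElem_append_left h, List.getD_eq_getElem _ _ h]
      · rw [List.getElem_append_right (by omega), List.getD_eq_default _ _ (by omega)]
        simp
  have hanti : Antitone f := by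
    intro i j hij
    simp only [f]
    by_cases h : (j : ℕ) < L.length
    · have hi : (i : ℕ) < L.length := lt_of_le_of_lt hij h
      rw [List.getD_eq_getElem _ _ h, List.getD_eq_getElem _ _ hi]
      rcases eq_or_lt_of_le hij with rfl | hlt
      · exact le_rfl
      · exact List.pairwise_iff_getElem.1 hLs _ _ hi h hlt
    · rw [List.getD_eq_default _ _ (by omega)]
      exact Nat.zero_le _
  have hms : (Finset.univ.val.map f : Multiset ℕ) =
      μ.parts + Multiset.replicate (n - L.length) 0 := by
    rw [Fin.univ_val_map, hf, ← Multiset.coe_add, hLe, Multiset.coe_replicate]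
  refine ⟨⟨Finsupp.equivFunOnFinite.symm f, hanti, ?_⟩, ?_⟩
  · rw [Finsupp.degree_eq_sum]
    change (Finset.univ.val.map f).sum = d
    rw [hms]
    simp [μ.parts_sum]
  · apply Nat.Partition.ext
    change (Finset.univ.val.map f).filter (· ≠ 0) = μ.parts
    rw [hms, Multiset.filter_add, Multiset.filter_eq_self.2, Multiset.filter_eq_nil.2, add_zero]
    · intro a ha
      simp [Multiset.eq_of_mem_replicate ha]
    · intro a ha
      exact (μ.parts_pos ha).ne'

theorem card_sortedExp {n d : ℕ} (hdn : d ≤ n) : Fintype.card (SortedExp n d) = P d :=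
  Fintype.card_of_bijective ⟨toPartition_injective n d, toPartition_surjective hdn⟩

theorem finrank_invForms {k : Type*} [Field k] {n d : ℕ} (hdn : d ≤ n) :
    Module.finrank k (invForms k n d) = P d := by
  rw [(invFormsEquiv k n d).finrank_eq, Module.finrank_fintype_fun_eq_card, card_sortedExp hdn]

end SymIdeal

end

/-! ### Rank bounds as Zariski open conditions -/

noncomputable section

namespace SymIdeal

section Rank

variable {k : Type*} [Field k]

theorem exists_dual_of_linearIndependent {E : Type*} [AddCommGroup E] [Module k E] {m : ℕ}
    {w : Fin m → E} (hw : LinearIndependent k w) :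
    ∃ φ : Fin m → Module.Dual k E, ∀ a b, φ a (w b) = if a = b then 1 else 0 := by
  obtain ⟨g, hg⟩ := LinearMap.exists_leftInverse_of_injective (Fintype.linearCombination k w)
    (LinearMap.ker_eq_bot.2 (linearIndependent_iff_injective_fintypeLinearCombination.1 hw))
  refine ⟨fun a => LinearMap.proj a ∘ₗ g, fun a b => ?_⟩
  have h1 : w b = Fintype.linearCombination k w (Pi.single b 1) := by
    rw [Fintype.linearCombination_apply_single, one_smul]
  have h2 := LinearMap.congr_fun hg (Pi.single b 1)
  rw [LinearMap.comp_apply, ← h1, LinearMap.id_apply] at h2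
  rw [LinearMap.comp_apply, h2, LinearMap.proj_apply, Pi.single_apply]

/-- Rank at least `m` means a nonzero `m × m` minor. Arbitrary functionals replace coordinates, so
no basis of `E` is needed and `ι` may be infinite. -/
theorem le_finrank_span_iff {E ι : Type*} [AddCommGroup E] [Module k E] {m : ℕ} (u : ι → E)
    [FiniteDimensional k (Submodule.span k (Set.range u))] :
    m ≤ Module.finrank k (Submodule.span k (Set.range u)) ↔
      ∃ (s : Fin m → ι) (φ : Fin m → Module.Dual k E),
        (Matrix.of fun a b => φ a (u (s b))).det ≠ 0 := by
  constructor
  · intro h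
    obtain ⟨κ, c, hc, hspan, hli⟩ := exists_linearIndependent' k u
    have hfd : FiniteDimensional k (Submodule.span k (Set.range (u ∘ c))) := by
      rw [hspan]; infer_instance
    have : Finite κ := by
      have hb := Module.Basis.span hli
      exact Module.Finite.finite_basis hb
    have := Fintype.ofFinite κ
    have hcard : m ≤ Fintype.card κ := by
      rw [← finrank_span_eq_card hli, hspan]; exact h
    obtain ⟨e⟩ : Nonempty (Fin m ↪ κ) := by
      apply Function.Embedding.nonempty_of_card_le; simpa using hcard
    obtain ⟨φ, hφ⟩ := exists_dual_of_linearIndependent (hli.comp e e.injective)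
    refine ⟨c ∘ e, φ, ?_⟩
    have : (Matrix.of fun a b => φ a (u ((c ∘ e) b))) = (1 : Matrix (Fin m) (Fin m) k) := by
      ext a b
      rw [Matrix.one_apply]
      exact hφ a b
    rw [this, Matrix.det_one]
    exact one_ne_zero
  · rintro ⟨s, φ, h⟩
    have hcols : LinearIndependent k (fun b a => φ a (u (s b))) := by
      have := Matrix.linearIndependent_cols_of_det_ne_zero h
      exact this
    have hli : LinearIndependent k (u ∘ s) :=
      LinearIndependent.of_comp (LinearMap.pi φ) hcols
    have h1 := finrank_span_eq_card hli
    rw [Fintype.card_fin] at h1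
    rw [← h1]
    exact Submodule.finrank_mono (Submodule.span_mono (Set.range_comp_subset_range _ _))

end Rank

section Open

variable {k : Type*} [Field k] {n : ℕ}

/-- The function `g` of `r`-tuples of forms of degree `d` is a polynomial in their coefficients. -/
def IsPolynomialFun (r d : ℕ) (g : (Fin r → MvPolynomial (Fin n) k) → k) : Prop :=
  ∃ p : MvPolynomial (Fin r × (Fin n →₀ ℕ)) k, ∀ v : Fin r → MvPolynomial (Fin n) k,
    (∀ j, v j ∈ forms k n d) → eval (fun ja => coeff ja.2 (v ja.1)) p = g v

/-- The condition `C` on `r`-tuples of forms of degree `d` is open in the Zariski topology. -/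
def IsOpenCondition (r d : ℕ) (C : (Fin r → MvPolynomial (Fin n) k) → Prop) : Prop :=
  ∃ F : Set (MvPolynomial (Fin r × (Fin n →₀ ℕ)) k), ∀ v : Fin r → MvPolynomial (Fin n) k,
    (∀ j, v j ∈ forms k n d) →
      (C v ↔ ∃ p ∈ F, eval (fun ja => coeff ja.2 (v ja.1)) p ≠ 0)

variable {r d : ℕ}

theorem IsPolynomialFun.const (c : k) :
    IsPolynomialFun r d (fun _ : Fin r → MvPolynomial (Fin n) k => c) :=
  ⟨C c, fun v _ => by simp⟩

theorem IsPolynomialFun.mul {g h : (Fin r → MvPolynomial (Fin n) k) → k}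
    (hg : IsPolynomialFun r d g) (hh : IsPolynomialFun r d h) :
    IsPolynomialFun r d (fun v => g v * h v) := by
  obtain ⟨p, hp⟩ := hg
  obtain ⟨q, hq⟩ := hh
  exact ⟨p * q, fun v hv => by rw [map_mul, hp v hv, hq v hv]⟩

theorem IsPolynomialFun.sum {ι : Type*} (s : Finset ι)
    {g : ι → (Fin r → MvPolynomial (Fin n) k) → k} (hg : ∀ i, IsPolynomialFun r d (g i)) :
    IsPolynomialFun r d (fun v => ∑ i ∈ s, g i v) := by
  choose p hp using hg
  exact ⟨∑ i ∈ s, p i, fun v hv => by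
    rw [map_sum]; exact Finset.sum_congr rfl fun i _ => hp i v hv⟩

theorem IsPolynomialFun.prod {ι : Type*} (s : Finset ι)
    {g : ι → (Fin r → MvPolynomial (Fin n) k) → k} (hg : ∀ i, IsPolynomialFun r d (g i)) :
    IsPolynomialFun r d (fun v => ∏ i ∈ s, g i v) := by
  choose p hp using hg
  exact ⟨∏ i ∈ s, p i, fun v hv => by
    rw [map_prod]; exact Finset.prod_congr rfl fun i _ => hp i v hv⟩

theorem form_eq_sum {f : MvPolynomial (Fin n) k} (hf : f ∈ forms k n d) :
    f = ∑ a : DegExp n d, coeff a.1 f • monomial a.1 (1 : k) := by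
  classical
  ext b
  rw [coeff_sum]
  simp only [coeff_smul, coeff_monomial, smul_eq_mul, mul_ite, mul_one, mul_zero]
  by_cases h : b.degree = d
  · rw [Finset.sum_eq_single ⟨b, h⟩]
    · simp
    · intro a _ ha
      rw [if_neg]
      exact fun e => ha (Subtype.ext e)
    · simp
  · rw [IsHomogeneous.coeff_eq_zero (mem_forms.1 hf) h, Finset.sum_eq_zero]
    intro a _
    rw [if_neg]
    rintro rfl
    exact h a.2

/-- Fixing the degree matters here: only finitely many coefficients can occur, so the functional is
a genuine polynomial in them. -/
theorem IsPolynomialFun.linear (ψ : MvPolynomial (Fin n) k →ₗ[k] k) (j : Fin r) :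
    IsPolynomialFun r d (fun v => ψ (v j)) := by
  refine ⟨∑ a : DegExp n d, C (ψ (monomial a.1 1)) * X (j, a.1), fun v hv => ?_⟩
  change _ = ψ (v j)
  conv_rhs => rw [form_eq_sum (hv j)]
  rw [map_sum, map_sum]
  refine Finset.sum_congr rfl fun a _ => ?_
  rw [map_mul, eval_C, eval_X, map_smul, smul_eq_mul, mul_comm]

theorem IsPolynomialFun.isOpenCondition {g : (Fin r → MvPolynomial (Fin n) k) → k}
    (hg : IsPolynomialFun r d g) : IsOpenCondition r d (fun v => g v ≠ 0) := by
  obtain ⟨p, hp⟩ := hg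
  exact ⟨{p}, fun v hv => by simp [hp v hv]⟩

theorem IsOpenCondition.exists {ι : Type*} {D : ι → (Fin r → MvPolynomial (Fin n) k) → Prop}
    (h : ∀ i, IsOpenCondition r d (D i)) : IsOpenCondition r d (fun v => ∃ i, D i v) := by
  choose F hF using h
  refine ⟨⋃ i, F i, fun v hv => ?_⟩
  simp only [Set.mem_iUnion]
  constructor
  · rintro ⟨i, hi⟩
    obtain ⟨p, hp, hne⟩ := (hF i v hv).1 hi
    exact ⟨p, ⟨i, hp⟩, hne⟩
  · rintro ⟨p, ⟨i, hp⟩, hne⟩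
    exact ⟨i, (hF i v hv).2 ⟨p, hp, hne⟩⟩

/-- Products of the defining polynomials define the intersection, since `k` has no zero divisors. -/
theorem IsOpenCondition.and {C D : (Fin r → MvPolynomial (Fin n) k) → Prop}
    (hC : IsOpenCondition r d C) (hD : IsOpenCondition r d D) :
    IsOpenCondition r d (fun v => C v ∧ D v) := by
  obtain ⟨F, hF⟩ := hC
  obtain ⟨F', hF'⟩ := hD
  refine ⟨Set.image2 (· * ·) F F', fun v hv => ?_⟩
  change C v ∧ D v ↔ _
  rw [hF v hv, hF' v hv]
  constructor
  · rintro ⟨⟨p, hp, hp0⟩, q, hq, hq0⟩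
    exact ⟨_, Set.mem_image2_of_mem hp hq, by rw [map_mul]; exact mul_ne_zero hp0 hq0⟩
  · rintro ⟨_, ⟨p, hp, q, hq, rfl⟩, h⟩
    rw [map_mul] at h
    exact ⟨⟨p, hp, left_ne_zero_of_mul h⟩, q, hq, right_ne_zero_of_mul h⟩

theorem isOpenCondition_rank {ι E : Type*} [AddCommGroup E] [Module k E] (m : ℕ)
    (u : ι → (Fin r → MvPolynomial (Fin n) k) → E)
    (hu : ∀ i (φ : Module.Dual k E), IsPolynomialFun r d (fun v => φ (u i v)))
    (hfd : ∀ v : Fin r → MvPolynomial (Fin n) k, (∀ j, v j ∈ forms k n d) →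
      FiniteDimensional k (Submodule.span k (Set.range fun i => u i v))) :
    IsOpenCondition r d
      (fun v => m ≤ Module.finrank k (Submodule.span k (Set.range fun i => u i v))) := by
  have h : IsOpenCondition r d (fun v => ∃ sφ : (Fin m → ι) × (Fin m → Module.Dual k E),
      (Matrix.of fun a b => sφ.2 a (u (sφ.1 b) v)).det ≠ 0) := by
    refine IsOpenCondition.exists fun sφ => IsPolynomialFun.isOpenCondition ?_
    simp only [Matrix.det_apply']
    exact IsPolynomialFun.sum _ fun σ => (IsPolynomialFun.const _).mul
      (IsPolynomialFun.prod _ fun i => hu _ _)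
  obtain ⟨F, hF⟩ := h
  refine ⟨F, fun v hv => ?_⟩
  rw [← hF v hv]
  have := hfd v hv
  exact (le_finrank_span_iff fun i => u i v).trans
    ⟨fun ⟨s, φ, h⟩ => ⟨(s, φ), h⟩, fun ⟨sφ, h⟩ => ⟨sφ.1, sφ.2, h⟩⟩

end Open

end SymIdeal

end

/-! ### The contraction pairing -/

noncomputable section

namespace SymIdeal

section Pairing

variable {k : Type*} [Field k] {n d : ℕ}

theorem contract_monomial (a : Fin n →₀ ℕ) (c : k) (w : DP k n) (e : Fin n →₀ ℕ) :
    contract k n (monomial a c) w e = c * w (e + a) := by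
  have h1 : (monomial a c : MvPolynomial (Fin n) k) = c • basisMonomials (Fin n) k a := by
    rw [coe_basisMonomials, smul_monomial, smul_eq_mul, mul_one]
  rw [h1, map_smul, contract, Module.Basis.constr_basis, LinearMap.smul_apply, Finsupp.smul_apply,
    smul_eq_mul]
  rfl

theorem contract_X (i : Fin n) (w : DP k n) (e : Fin n →₀ ℕ) :
    contract k n (X i) w e = w (e + Finsupp.single i 1) := by
  rw [X, contract_monomial, one_mul]

theorem contract_mul (f g : MvPolynomial (Fin n) k) (w : DP k n) :
    contract k n (f * g) w = contract k n f (contract k n g w) := by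
  induction f using MvPolynomial.induction_on' with
  | add p q hp hq => rw [add_mul, map_add, map_add, LinearMap.add_apply, LinearMap.add_apply, hp, hq]
  | monomial a c =>
    induction g using MvPolynomial.induction_on' with
    | add p q hp hq =>
      rw [mul_add, map_add, map_add, LinearMap.add_apply, LinearMap.add_apply, hp, hq, map_add]
    | monomial b c' =>
      ext e
      rw [monomial_mul, contract_monomial, contract_monomial, contract_monomial, mul_assoc,
        add_assoc]

/-- The pairing of `R_d` with `S_{-d}`. -/
def pair (k : Type*) [Field k] (n : ℕ) : MvPolynomial (Fin n) k →ₗ[k] DP k n →ₗ[k] k :=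
  (contract k n).compr₂ (Finsupp.lapply 0)

theorem pair_monomial (a : Fin n →₀ ℕ) (c : k) (w : DP k n) :
    pair k n (monomial a c) w = c * w a := by
  change contract k n (monomial a c) w 0 = _
  rw [contract_monomial, zero_add]

theorem pair_mul (f g : MvPolynomial (Fin n) k) (w : DP k n) :
    pair k n (f * g) w = pair k n f (contract k n g w) := by
  change contract k n (f * g) w 0 = _
  rw [contract_mul]; rfl

theorem mem_invDP {w : DP k n} : w ∈ invDP k n d ↔
    (∀ e, e.degree ≠ d → w e = 0) ∧
      ∀ (σ : Equiv.Perm (Fin n)) (e : Fin n →₀ ℕ), w (e.mapDomain σ) = w e := by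
  rw [invDP, Submodule.mem_inf, Submodule.mem_iInf, Finsupp.mem_supported']
  refine and_congr Iff.rfl (forall_congr' fun σ => ?_)
  have hinj : Function.Injective (Finsupp.mapDomain (M := ℕ) (σ : Fin n → Fin n)) :=
    Finsupp.mapDomain_injective σ.injective
  rw [LinearMap.mem_eqLocus, LinearMap.id_apply, Finsupp.lmapDomain_apply]
  constructor
  · intro h e
    conv_lhs => rw [← h]
    exact Finsupp.mapDomain_apply hinj w e
  · intro h
    ext e
    obtain ⟨e', rfl⟩ : ∃ e', Finsupp.mapDomain σ e' = e :=
      ⟨e.mapDomain (σ⁻¹ : Equiv.Perm (Fin n)), by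
        rw [← mapDomain_mul_perm, mul_inv_cancel]; exact Finsupp.mapDomain_id⟩
    rw [Finsupp.mapDomain_apply hinj, h]

theorem pair_eq_sum {u : MvPolynomial (Fin n) k} (hu : u ∈ forms k n d) (w : DP k n) :
    pair k n u w = ∑ a : DegExp n d, coeff a.1 u * w a.1 := by
  conv_lhs => rw [form_eq_sum hu]
  rw [map_sum, LinearMap.sum_apply]
  refine Finset.sum_congr rfl fun a _ => ?_
  rw [map_smul, LinearMap.smul_apply, pair_monomial, one_mul, smul_eq_mul]

/-- The contraction has degree `0`, so its vanishing is a single scalar equation. -/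
theorem contract_eq_zero_iff {u : MvPolynomial (Fin n) k} (hu : u ∈ forms k n d) {w : DP k n}
    (hw : ∀ e, e.degree ≠ d → w e = 0) : contract k n u w = 0 ↔ pair k n u w = 0 := by
  constructor
  · intro h
    change contract k n u w 0 = 0
    rw [h]; rfl
  · intro h
    ext e
    by_cases he : e = 0
    · rw [he]; exact h
    · rw [form_eq_sum hu, map_sum, LinearMap.sum_apply, Finsupp.finsetSum_apply]
      refine Finset.sum_eq_zero fun a _ => ?_
      rw [map_smul, LinearMap.smul_apply, Finsupp.smul_apply, contract_monomial, hw, mul_zero,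
        smul_zero]
      rw [map_add, a.2]
      have : e.degree ≠ 0 := fun h0 => he ((Finsupp.degree_eq_zero_iff e).1 h0)
      omega

theorem mem_perp {U : Submodule k (MvPolynomial (Fin n) k)} (hU : U ≤ forms k n d) {w : DP k n} :
    w ∈ perp d U ↔ w ∈ invDP k n d ∧ ∀ u ∈ U, pair k n u w = 0 := by
  rw [perp, Submodule.mem_inf]
  refine and_congr_right fun hw => ?_
  simp only [Submodule.mem_iInf, LinearMap.mem_ker]
  exact forall₂_congr fun u hu => contract_eq_zero_iff (hU hu) (mem_invDP.1 hw).1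

theorem pair_rename (σ : Equiv.Perm (Fin n)) (u : MvPolynomial (Fin n) k) {w : DP k n}
    (hw : w ∈ invDP k n d) : pair k n (rename σ u) w = pair k n u w := by
  induction u using MvPolynomial.induction_on' with
  | add p q hp hq =>
    rw [map_add, map_add, map_add, LinearMap.add_apply, LinearMap.add_apply, hp, hq]
  | monomial a c => rw [rename_monomial, pair_monomial, pair_monomial, (mem_invDP.1 hw).2]

theorem pair_reynolds (hf : (n.factorial : k) ≠ 0) (u : MvPolynomial (Fin n) k) {w : DP k n}
    (hw : w ∈ invDP k n d) : pair k n (reynolds k n u) w = pair k n u w := by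
  rw [reynolds_apply, map_smul, map_sum, LinearMap.smul_apply, LinearMap.sum_apply,
    Finset.sum_congr rfl fun σ _ => pair_rename σ u hw, Finset.sum_const, Finset.card_univ,
    Fintype.card_perm, Fintype.card_fin, ← Nat.cast_smul_eq_nsmul k, smul_smul,
    inv_mul_cancel₀ hf, one_smul]

/-- An invariant `w` pairs equally with a monomial and with its Reynolds average, and the monomials
detect its coefficients. -/
theorem eq_zero_of_pair_right (hf : (n.factorial : k) ≠ 0) {w : DP k n} (hw : w ∈ invDP k n d)
    (h : ∀ u ∈ invForms k n d, pair k n u w = 0) : w = 0 := by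
  ext e
  by_cases he : e.degree = d
  · have h1 := h _ (reynolds_mem_invForms (mem_forms.2 (isHomogeneous_monomial (1 : k) he)))
    rwa [pair_reynolds hf _ hw, pair_monomial, one_mul] at h1
  · exact (mem_invDP.1 hw).1 e he

/-- The sum of the rearrangements of a divided monomial. -/
def orbitSumDP (k : Type*) [Field k] {n : ℕ} (a : Fin n →₀ ℕ) : DP k n :=
  ∑ σ : Equiv.Perm (Fin n), Finsupp.single (a.mapDomain σ) 1

theorem orbitSumDP_mem {a : Fin n →₀ ℕ} (ha : a.degree = d) : orbitSumDP k a ∈ invDP k n d := by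
  classical
  refine mem_invDP.2 ⟨fun e he => ?_, fun τ e => ?_⟩
  · rw [orbitSumDP, Finsupp.finsetSum_apply]
    refine Finset.sum_eq_zero fun σ _ => ?_
    rw [Finsupp.single_apply, if_neg]
    rintro rfl
    exact he ((degree_mapDomain_perm σ a).trans ha)
  · rw [orbitSumDP, Finsupp.finsetSum_apply, Finsupp.finsetSum_apply]
    symm
    refine Fintype.sum_equiv (Equiv.mulLeft τ) _ _ fun σ => ?_
    rw [Equiv.coe_mulLeft, mapDomain_mul_perm, Finsupp.single_apply, Finsupp.single_apply]
    refine if_congr ?_ rfl rfl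
    exact (Finsupp.mapDomain_injective τ.injective).eq_iff.symm

/-- Pairing a symmetric `u` with the orbit sum of `a` gives `n!` times the coefficient of `u` at
`a`. -/
theorem eq_zero_of_pair_left (hf : (n.factorial : k) ≠ 0) {u : MvPolynomial (Fin n) k}
    (hu : u ∈ invForms k n d) (h : ∀ w ∈ invDP k n d, pair k n u w = 0) : u = 0 := by
  classical
  ext a
  rw [coeff_zero]
  by_cases ha : a.degree = d
  · have h1 := h _ (orbitSumDP_mem ha)
    have h2 : ∀ σ : Equiv.Perm (Fin n),
        pair k n u (Finsupp.single (a.mapDomain σ) 1) = coeff a u := by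
      intro σ
      have hd : (a.mapDomain σ).degree = d := (degree_mapDomain_perm σ a).trans ha
      rw [pair_eq_sum (invForms_le_forms _ _ _ hu),
        Finset.sum_eq_single ⟨a.mapDomain σ, hd⟩, Finsupp.single_eq_same, mul_one]
      · exact coeff_mapDomain_of_symm σ ((mem_invForms.1 hu).1 σ) a
      · intro b _ hb
        rw [Finsupp.single_apply, if_neg, mul_zero]
        exact fun e => hb (Subtype.ext e.symm)
      · simp
    rw [orbitSumDP, map_sum, Finset.sum_congr rfl fun σ _ => h2 σ, Finset.sum_const,
      Finset.card_univ, Fintype.card_perm, Fintype.card_fin, nsmul_eq_mul] at h1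
    exact (mul_eq_zero.1 h1).resolve_left hf
  · exact IsHomogeneous.coeff_eq_zero (mem_forms.1 (invForms_le_forms _ _ _ hu)) ha

/-- Nondegeneracy on both sides forces equal dimensions, so `B` identifies `N` with the dual of `M`.
-/
theorem finrank_comap_dualAnnihilator {M N : Type*} [AddCommGroup M] [Module k M]
    [AddCommGroup N] [Module k N] [FiniteDimensional k M] (B : N →ₗ[k] Module.Dual k M)
    (hB : ∀ w, B w = 0 → w = 0) (hB' : ∀ u, (∀ w, B w u = 0) → u = 0) (U : Submodule k M) :
    Module.finrank k (U.dualAnnihilator.comap B) + Module.finrank k U = Module.finrank k M := by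
  have hinj : Function.Injective B := (injective_iff_map_eq_zero B).2 hB
  have : FiniteDimensional k N := FiniteDimensional.of_injective B hinj
  have hinj' : Function.Injective B.flip :=
    (injective_iff_map_eq_zero B.flip).2 fun u hu => hB' u fun w => LinearMap.congr_fun hu w
  have h1 : Module.finrank k N ≤ Module.finrank k M :=
    (LinearMap.finrank_le_finrank_of_injective hinj).trans_eq Subspace.dual_finrank_eq
  have h2 : Module.finrank k M ≤ Module.finrank k N :=
    (LinearMap.finrank_le_finrank_of_injective (f := (B.flip : M →ₗ[k] Module.Dual k N))
      hinj').trans_eq Subspace.dual_finrank_eq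
  let β : N ≃ₗ[k] Module.Dual k M := LinearEquiv.ofInjectiveOfFinrankEq B hinj
    ((h1.antisymm h2).trans Subspace.dual_finrank_eq.symm)
  have h3 : Module.finrank k (U.dualAnnihilator.comap B) =
      Module.finrank k U.dualAnnihilator := by
    have : U.dualAnnihilator.comap B = U.dualAnnihilator.comap (β : N →ₗ[k] Module.Dual k M) := rfl
    rw [this, Submodule.comap_equiv_eq_map_symm]
    exact LinearEquiv.finrank_map_eq β.symm _
  rw [h3, add_comm]
  exact Subspace.finrank_add_finrank_dualAnnihilator_eq U

/-- The pairing of the invariants of `S` in degree `-d` with the symmetric forms. -/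
def invPair (k : Type*) [Field k] (n d : ℕ) :
    invDP k n d →ₗ[k] Module.Dual k (invForms k n d) :=
  ((pair k n).domRestrict₁₂ (invForms k n d) (invDP k n d)).flip

theorem finrank_perp_add (hf : (n.factorial : k) ≠ 0)
    {U : Submodule k (MvPolynomial (Fin n) k)} (hU : U ≤ invForms k n d) :
    Module.finrank k (perp d U) + Module.finrank k U = Module.finrank k (invForms k n d) := by
  have h1 : (perp d U).submoduleOf (invDP k n d) =
      (U.submoduleOf (invForms k n d)).dualAnnihilator.comap (invPair k n d) := by
    ext ⟨w, hw⟩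
    rw [Submodule.mem_comap, Submodule.mem_dualAnnihilator]
    change w ∈ perp d U ↔ _
    rw [mem_perp (hU.trans (invForms_le_forms k n d))]
    constructor
    · rintro ⟨-, h⟩ ⟨u, hu⟩ huU
      exact h u huU
    · intro h
      exact ⟨hw, fun u hu => h ⟨u, hU hu⟩ hu⟩
  have h2 := finrank_comap_dualAnnihilator (invPair k n d)
    (fun w h => Subtype.ext (eq_zero_of_pair_right hf w.2 fun u hu =>
      LinearMap.congr_fun h ⟨u, hu⟩))
    (fun u h => Subtype.ext (eq_zero_of_pair_left hf u.2 fun w hw => h ⟨w, hw⟩))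
    (U.submoduleOf (invForms k n d))
  have hp : perp d U ≤ invDP k n d := inf_le_left
  rw [← h1, (Submodule.submoduleOfEquivOfLe hp).finrank_eq,
    (Submodule.submoduleOfEquivOfLe hU).finrank_eq] at h2
  exact h2

end Pairing
end SymIdeal

end

/-! ### A description of `G` by coefficient sums and a rank bound -/

noncomputable section

namespace SymIdeal

variable {k : Type*} [Field k] {n d : ℕ}

/-- Any two exponent vectors of the same degree are linked by moving one unit at a time between
positions. -/
theorem eq_of_shift_eq {n : ℕ} {A : Type*} (d : ℕ) (c : (Fin n →₀ ℕ) → A)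
    (h : ∀ e : Fin n →₀ ℕ, e.degree + 1 = d → ∀ i j,
      c (e + Finsupp.single i 1) = c (e + Finsupp.single j 1)) (a b : Fin n →₀ ℕ)
    (ha : a.degree = d) (hb : b.degree = d) : c a = c b := by
  have key : ∀ (a : Fin n →₀ ℕ) (d : ℕ), a.degree = d + 1 →
      ∃ (i : Fin n) (e : Fin n →₀ ℕ), e.degree = d ∧ a = e + Finsupp.single i 1 := by
    intro a d ha
    obtain ⟨i, hi⟩ : ∃ i, a i ≠ 0 := by
      by_contra hcon
      push Not at hcon
      have : a = 0 := Finsupp.ext hcon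
      rw [this, map_zero] at ha
      omega
    have hle : Finsupp.single i 1 ≤ a := by
      rw [Finsupp.single_le_iff]; omega
    refine ⟨i, a - Finsupp.single i 1, ?_, (tsub_add_cancel_of_le hle).symm⟩
    have h1 := congrArg Finsupp.degree (tsub_add_cancel_of_le hle)
    rw [map_add, Finsupp.degree_single, ha] at h1
    omega
  induction d generalizing c a b with
  | zero =>
    rw [(Finsupp.degree_eq_zero_iff a).1 ha, (Finsupp.degree_eq_zero_iff b).1 hb]
  | succ d ih =>
    obtain ⟨i, e, he, rfl⟩ := key a d ha
    obtain ⟨j, e', he', rfl⟩ := key b d hb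
    rw [h e (by omega) i j]
    refine ih (fun x => c (x + Finsupp.single j 1)) (fun x hx i' j' => ?_) e e' he he'
    have := h (x + Finsupp.single j 1) (by rw [map_add, Finsupp.degree_single]; omega) i' j'
    simpa only [add_right_comm] using this

theorem exists_perm_map_pair {α : Type*} [DecidableEq α] {a b i j : α} (hab : a ≠ b)
    (hij : i ≠ j) : ∃ σ : Equiv.Perm α, σ a = i ∧ σ b = j := by
  refine ⟨Equiv.swap (Equiv.swap a i b) j * Equiv.swap a i, ?_, ?_⟩
  · rw [Equiv.Perm.mul_apply, Equiv.swap_apply_left]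
    refine Equiv.swap_apply_of_ne_of_ne ?_ hij
    intro h1
    exact hab ((Equiv.swap a i).injective ((Equiv.swap_apply_left a i).trans h1))
  · rw [Equiv.Perm.mul_apply, Equiv.swap_apply_left]

/-- By invariance, `(x_a - x_b) ∘ F = 0` for one pair gives it for every pair. So `F` is constant on
exponents of degree `d`, and pairing with `u` yields that constant times the coefficient sum of `u`.
-/
theorem eq_zero_of_shift_eq_of_mem_perp {U : Submodule k (MvPolynomial (Fin n) k)}
    (hU : U ≤ invForms k n d) {u : MvPolynomial (Fin n) k} (huU : u ∈ U)
    (hu : coeffSum k n u ≠ 0) {F : DP k n} (hF : F ∈ perp d U) {a b : Fin n} (hab : a ≠ b)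
    (h : ∀ e, F (e + Finsupp.single a 1) = F (e + Finsupp.single b 1)) : F = 0 := by
  have hUf := hU.trans (invForms_le_forms k n d)
  obtain ⟨hFi, hFU⟩ := (mem_perp hUf).1 hF
  obtain ⟨hF0, hFs⟩ := mem_invDP.1 hFi
  have hshift : ∀ (e : Fin n →₀ ℕ) i j,
      F (e + Finsupp.single i 1) = F (e + Finsupp.single j 1) := by
    intro e i j
    rcases eq_or_ne i j with rfl | hij
    · rfl
    obtain ⟨σ, hσa, hσb⟩ := exists_perm_map_pair hab hij
    have he : (e.mapDomain (σ⁻¹ : Equiv.Perm (Fin n))).mapDomain σ = e := by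
      rw [← mapDomain_mul_perm, mul_inv_cancel]; exact Finsupp.mapDomain_id
    have h1 : ∀ x, e + Finsupp.single (σ x) 1 =
        (e.mapDomain (σ⁻¹ : Equiv.Perm (Fin n)) + Finsupp.single x 1).mapDomain σ := by
      intro x
      rw [Finsupp.mapDomain_add, he, Finsupp.mapDomain_single]
    rw [← hσa, ← hσb, h1, h1, hFs, hFs]
    exact h _
  ext e
  by_cases he : e.degree = d
  · have hconst : ∀ x : Fin n →₀ ℕ, x.degree = d → F x = F e := fun x hx =>
      eq_of_shift_eq d F (fun e _ i j => hshift e i j) x e hx he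
    have h0 := hFU u huU
    rw [pair_eq_sum (hUf huU), Finset.sum_congr rfl fun a _ => by rw [hconst a.1 a.2],
      ← Finset.sum_mul] at h0
    have h2 : coeffSum k n u = ∑ a : DegExp n d, coeff a.1 u := by
      conv_lhs => rw [form_eq_sum (hUf huU)]
      rw [map_sum]
      refine Finset.sum_congr rfl fun a _ => ?_
      rw [map_smul, coeffSum_monomial, smul_eq_mul, mul_one]
    rw [← h2] at h0
    exact (mul_eq_zero.1 h0).resolve_left hu
  · exact hF0 e he

theorem propQ_perp_iff {U : Submodule k (MvPolynomial (Fin n) k)} (hU : U ≤ invForms k n d)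
    (hn : 2 ≤ n) : PropQ (perp d U) ↔ ∃ u ∈ U, coeffSum k n u ≠ 0 := by
  have hUf := hU.trans (invForms_le_forms k n d)
  constructor
  · intro hQ
    by_contra hcon
    push Not at hcon
    classical
    -- Pairing with the sum of all divided monomials of degree `d` is the coefficient sum, and every
    -- `x_i - x_j` annihilates it.
    let w : DP k n := ∑ a : DegExp n d, Finsupp.single a.1 1
    have hw : ∀ e, w e = if e.degree = d then 1 else 0 := by
      intro e
      simp only [w, Finsupp.finsetSum_apply, Finsupp.single_apply]
      split_ifs with h
      · rw [Finset.sum_eq_single ⟨e, h⟩]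
        · simp
        · intro b _ hb
          rw [if_neg]
          exact fun e => hb (Subtype.ext e)
        · simp
      · refine Finset.sum_eq_zero fun a _ => ?_
        rw [if_neg]
        rintro rfl
        exact h a.2
    have hwp : w ∈ perp d U := by
      refine (mem_perp hUf).2 ⟨mem_invDP.2 ⟨fun e he => by rw [hw, if_neg he],
        fun σ e => by rw [hw, hw, degree_mapDomain_perm]⟩, fun u hu => ?_⟩
      rw [← hcon u hu]
      conv_rhs => rw [form_eq_sum (hUf hu)]
      rw [pair_eq_sum (hUf hu), map_sum]
      refine Finset.sum_congr rfl fun a _ => ?_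
      rw [map_smul, coeffSum_monomial, smul_eq_mul, hw, if_pos a.2]
    have h0 := hQ ⟨0, by omega⟩ ⟨1, by omega⟩ rfl rfl w hwp (by
      ext e
      rw [map_sub, LinearMap.sub_apply, Finsupp.sub_apply, contract_X, contract_X, hw, hw, map_add,
        map_add, Finsupp.degree_single, Finsupp.degree_single, sub_self]; rfl)
    have h1 := hw (Finsupp.single ⟨0, by omega⟩ d)
    rw [Finsupp.degree_single, if_pos rfl, h0] at h1
    exact zero_ne_one h1
  · rintro ⟨u, huU, hu⟩ i j hi hj F hF h
    have hij : i ≠ j := by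
      intro e
      rw [e, hj] at hi
      omega
    refine eq_zero_of_shift_eq_of_mem_perp hU huU hu hF hij fun e => ?_
    have h1 := DFunLike.congr_fun h e
    rw [map_sub, LinearMap.sub_apply, Finsupp.sub_apply, contract_X, contract_X] at h1
    exact sub_eq_zero.1 h1

theorem mem_linSyz {W : Submodule k (DP k n)} {w : Fin n → W} :
    w ∈ linSyz W ↔ ∑ i, contract k n (X i) (w i : DP k n) = 0 := by
  rw [linSyz, LinearMap.mem_ker, LinearMap.sum_apply]
  rfl

/-- Subtracting from a syzygy its image under the transposition `(a b)` leaves `(x_a - x_b) ∘ (w_a -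
w_b) = 0`. Hence property (ii) follows from the coefficient-sum form of (i). -/
theorem propP_perp {U : Submodule k (MvPolynomial (Fin n) k)}
    (hU : U ≤ invForms k n d) {u : MvPolynomial (Fin n) k} (huU : u ∈ U)
    (hu : coeffSum k n u ≠ 0) : PropP (perp d U) := by
  have hUf := hU.trans (invForms_le_forms k n d)
  intro w hw a b
  rcases eq_or_ne a b with rfl | hab
  · rfl
  rw [mem_linSyz] at hw
  have hrel : ∀ e : Fin n →₀ ℕ, ∑ i, (w i : DP k n) (e + Finsupp.single i 1) = 0 := by
    intro e
    have h1 := DFunLike.congr_fun hw e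
    rw [Finsupp.finsetSum_apply] at h1
    simp only [contract_X] at h1
    exact h1
  have hswap : ∀ e : Fin n →₀ ℕ,
      ∑ i, (w i : DP k n) (e + Finsupp.single (Equiv.swap a b i) 1) = 0 := by
    intro e
    rw [← hrel (e.mapDomain (Equiv.swap a b))]
    refine Finset.sum_congr rfl fun i _ => ?_
    have hi := (mem_invDP.1 ((mem_perp hUf).1 (w i).2).1).2 (Equiv.swap a b)
    rw [← hi, Finsupp.mapDomain_add, Finsupp.mapDomain_single, Equiv.swap_apply_self]
  refine Subtype.ext (sub_eq_zero.1 ?_)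
  refine eq_zero_of_shift_eq_of_mem_perp hU huU hu
    (Submodule.sub_mem _ (w a).2 (w b).2) hab fun e => ?_
  have h1 := (hrel e).trans (hswap e).symm
  rw [← sub_eq_zero, ← Finset.sum_sub_distrib, ← Finset.sum_subset (Finset.subset_univ {a, b}),
    Finset.sum_pair hab, Equiv.swap_apply_left, Equiv.swap_apply_right] at h1
  · rw [Finsupp.sub_apply, Finsupp.sub_apply]
    linear_combination h1
  · intro i _ hi
    rw [Finset.mem_insert, Finset.mem_singleton, not_or] at hi
    rw [Equiv.swap_apply_of_ne_of_ne hi.1 hi.2, sub_self]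

/-- The sum of the variables. -/
def sumX (k : Type*) [Field k] (n : ℕ) : MvPolynomial (Fin n) k := ∑ i, X i

theorem sumX_mem : sumX k n ∈ invForms k n 1 := by
  refine mem_invForms.2 ⟨fun σ => ?_, Submodule.sum_mem _ fun i _ => isHomogeneous_X _ _⟩
  rw [sumX, map_sum]
  simp only [rename_X]
  exact Equiv.sum_comp σ fun i => (X i : MvPolynomial (Fin n) k)

theorem coeffSum_sumX : coeffSum k n (sumX k n) = n := by
  rw [sumX, map_sum]
  simp [X, coeffSum_monomial]

theorem sumX_ne_zero (hn : 0 < n) : sumX k n ≠ 0 := by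
  classical
  intro h
  have h1 := congrArg (coeff (Finsupp.single ⟨0, hn⟩ 1)) h
  rw [sumX, coeff_sum, Finset.sum_eq_single ⟨0, hn⟩] at h1
  · simp at h1
  · intro b _ hb
    rw [coeff_X, if_neg]
    intro e
    exact hb (Finsupp.single_left_injective one_ne_zero e)
  · simp

theorem mul_mem_invForms {d e : ℕ} {f g : MvPolynomial (Fin n) k} (hf : f ∈ invForms k n d)
    (hg : g ∈ invForms k n e) : f * g ∈ invForms k n (d + e) := by
  rw [mem_invForms] at hf hg ⊢
  refine ⟨fun σ => by rw [map_mul, hf.1, hg.1], ?_⟩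
  exact (mem_forms.1 hf.2).mul (mem_forms.1 hg.2)

/-- The multiples of the sum of the variables among the symmetric forms. -/
def sumXMultiples (k : Type*) [Field k] (n d : ℕ) : Submodule k (MvPolynomial (Fin n) k) :=
  (invForms k n (d - 1)).map (LinearMap.mulRight k (sumX k n))

theorem sumXMultiples_le (hd : 0 < d) : sumXMultiples k n d ≤ invForms k n d := by
  rintro _ ⟨f, hf, rfl⟩
  have := mul_mem_invForms hf (sumX_mem (k := k) (n := n))
  rwa [Nat.sub_add_cancel hd] at this

theorem finrank_sumXMultiples (hn : 0 < n) :
    Module.finrank k (sumXMultiples k n d) = Module.finrank k (invForms k n (d - 1)) := by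
  have hinj : Function.Injective (LinearMap.mulRight k (sumX k n)) :=
    mul_left_injective₀ (sumX_ne_zero hn)
  exact (Submodule.equivMapOfInjective _ hinj _).finrank_eq.symm

/-- By (ii) a syzygy is a constant family `F` with `e_1 ∘ F = 0`. Since contraction is adjoint to
multiplication, this says that `F` is orthogonal to `e_1 R'_{d-1}`. -/
theorem finrank_linSyz (hf : (n.factorial : k) ≠ 0) (hd : 0 < d) (hn : 0 < n)
    {U : Submodule k (MvPolynomial (Fin n) k)} (hU : U ≤ invForms k n d)
    (hP : PropP (perp d U)) :
    Module.finrank k (linSyz (perp d U)) =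
      Module.finrank k (perp d (U ⊔ sumXMultiples k n d)) := by
  have hUf := hU.trans (invForms_le_forms k n d)
  have hS : U ⊔ sumXMultiples k n d ≤ forms k n d :=
    sup_le hUf ((sumXMultiples_le hd).trans (invForms_le_forms k n d))
  let i0 : Fin n := ⟨0, hn⟩
  let φ : linSyz (perp d U) →ₗ[k] DP k n :=
    (perp d U).subtype ∘ₗ LinearMap.proj i0 ∘ₗ (linSyz (perp d U)).subtype
  have hφ : Function.Injective φ := by
    rintro ⟨w, hw⟩ ⟨w', hw'⟩ h
    apply Subtype.ext
    funext i
    change w i = w' i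
    rw [hP w hw i i0, hP w' hw' i i0]
    exact Subtype.ext h
  have hcon : ∀ F : DP k n, contract k n (sumX k n) F = ∑ i, contract k n (X i) F := by
    intro F
    rw [sumX, map_sum, LinearMap.sum_apply]
  rw [← LinearMap.finrank_range_of_inj hφ]
  suffices h : LinearMap.range φ = perp d (U ⊔ sumXMultiples k n d) by rw [h]
  ext F
  rw [LinearMap.mem_range, mem_perp hS]
  constructor
  · rintro ⟨⟨w, hw⟩, rfl⟩
    have hw0 := (mem_perp hUf).1 (w i0).2
    refine ⟨hw0.1, fun u hu => ?_⟩
    obtain ⟨u1, hu1, _, ⟨f, hf', rfl⟩, rfl⟩ := Submodule.mem_sup.1 hu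
    rw [map_add, LinearMap.add_apply]
    change pair k n u1 (w i0 : DP k n) + pair k n (f * sumX k n) (w i0 : DP k n) = 0
    rw [hw0.2 u1 hu1, zero_add, pair_mul, hcon]
    have h1 := mem_linSyz.1 hw
    rw [Finset.sum_congr rfl fun i _ => by rw [hP w hw i i0]] at h1
    rw [h1, map_zero]
  · rintro ⟨hF, h⟩
    have hFU : F ∈ perp d U :=
      (mem_perp hUf).2 ⟨hF, fun u hu => h u (Submodule.mem_sup_left hu)⟩
    refine ⟨⟨fun _ => ⟨F, hFU⟩, ?_⟩, rfl⟩
    rw [mem_linSyz]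
    change ∑ i, contract k n (X i) F = 0
    rw [← hcon]
    obtain ⟨hF0, hFs⟩ := mem_invDP.1 hF
    have happ : ∀ e, contract k n (sumX k n) F e = ∑ i, F (e + Finsupp.single i 1) := by
      intro e
      rw [hcon, Finsupp.finsetSum_apply]
      simp only [contract_X]
    refine eq_zero_of_pair_right (d := d - 1) hf (mem_invDP.2 ⟨fun e he => ?_, fun σ e => ?_⟩) ?_
    · rw [happ]
      refine Finset.sum_eq_zero fun i _ => hF0 _ ?_
      rw [map_add, Finsupp.degree_single]
      omega
    · rw [happ, happ, ← Equiv.sum_comp σ]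
      refine Finset.sum_congr rfl fun i _ => ?_
      rw [← hFs σ (e + _), Finsupp.mapDomain_add, Finsupp.mapDomain_single]
    · intro u hu
      rw [← pair_mul]
      exact h _ (Submodule.mem_sup_right ⟨u, hu, rfl⟩)

/-- Duality turns the prescribed dimension of `L_W` into `dim (U + e_1 R'_{d-1}) = min (P d, P (d-1)
+ r)`. The upper bound is automatic, which leaves an open condition. -/
theorem mem_G_iff {r : ℕ} (hf : (n.factorial : k) ≠ 0) (hd : 0 < d) (hdn : d < n)
    {U : Submodule k (MvPolynomial (Fin n) k)} :
    U ∈ G k n r d ↔ U ∈ Gr r (invForms k n d) ∧ (∃ u ∈ U, coeffSum k n u ≠ 0) ∧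
      min (P d) (P (d - 1) + r) ≤ Module.finrank k ↥(U ⊔ sumXMultiples k n d) := by
  rw [G, Set.mem_ofPred_eq]
  refine and_congr_right fun hG => ?_
  rw [propQ_perp_iff hG.1 (by omega)]
  refine and_congr_right ?_
  rintro ⟨u, huU, hu⟩
  have hP := propP_perp hG.1 huU hu
  rw [and_iff_right hP, finrank_linSyz hf hd (by omega) hG.1 hP]
  have hle : U ⊔ sumXMultiples k n d ≤ invForms k n d := sup_le hG.1 (sumXMultiples_le hd)
  have h1 := finrank_perp_add hf hle
  rw [finrank_invForms hdn.le] at h1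
  have : FiniteDimensional k U := Submodule.finiteDimensional_of_le hG.1
  have : FiniteDimensional k (sumXMultiples k n d) :=
    Submodule.finiteDimensional_of_le (sumXMultiples_le hd)
  have h2 := Submodule.finrank_add_le_finrank_add_finrank U (sumXMultiples k n d)
  rw [hG.2, finrank_sumXMultiples (by omega), finrank_invForms (by omega)] at h2
  omega

end SymIdeal

end

/-! ### The degree `d` part of the ideal and openness of `O` -/

noncomputable section

namespace SymIdeal

variable {k : Type*} [Field k] {n d : ℕ}

/-- The span of the orbits of the elements of `V`. -/
def orbitSpan (V : Submodule k (MvPolynomial (Fin n) k)) : Submodule k (MvPolynomial (Fin n) k) :=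
  Submodule.span k {g | ∃ σ : Equiv.Perm (Fin n), ∃ f ∈ V, g = rename σ f}

theorem rename_mem_orbitSpan {V : Submodule k (MvPolynomial (Fin n) k)}
    {f : MvPolynomial (Fin n) k} (hf : f ∈ V) (σ : Equiv.Perm (Fin n)) :
    rename σ f ∈ orbitSpan V :=
  Submodule.subset_span ⟨σ, f, hf, rfl⟩

theorem orbitSpan_le_forms {V : Submodule k (MvPolynomial (Fin n) k)} (hV : V ≤ forms k n d) :
    orbitSpan V ≤ forms k n d := by
  refine Submodule.span_le.2 ?_
  rintro _ ⟨σ, f, hf, rfl⟩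
  exact rename_mem_forms (hV hf) σ

theorem rename_mem_orbitSpan_of_mem {V : Submodule k (MvPolynomial (Fin n) k)}
    {f : MvPolynomial (Fin n) k} (hf : f ∈ orbitSpan V) (σ : Equiv.Perm (Fin n)) :
    rename σ f ∈ orbitSpan V := by
  induction hf using Submodule.span_induction with
  | mem x hx =>
    obtain ⟨τ, g, hg, rfl⟩ := hx
    rw [← rename_mul_perm]
    exact rename_mem_orbitSpan hg _
  | zero => rw [map_zero]; exact Submodule.zero_mem _
  | add x y _ _ hx hy => rw [map_add]; exact Submodule.add_mem _ hx hy
  | smul c x _ hx => rw [map_smul]; exact Submodule.smul_mem _ _ hx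

theorem homogeneousComponent_mul_of_mem_forms {g : MvPolynomial (Fin n) k}
    (hg : g ∈ forms k n d) (a : MvPolynomial (Fin n) k) :
    homogeneousComponent d (a * g) = coeff 0 a • g ∧
      ∀ i < d, homogeneousComponent i (a * g) = 0 := by
  induction a using MvPolynomial.induction_on' with
  | add p q hp hq =>
    refine ⟨by rw [add_mul, map_add, hp.1, hq.1, coeff_add, add_smul], fun i hi => ?_⟩
    rw [add_mul, map_add, hp.2 i hi, hq.2 i hi, add_zero]
  | monomial b c =>
    have h1 : monomial b c * g ∈ homogeneousSubmodule (Fin n) k (b.degree + d) :=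
      (isHomogeneous_monomial c rfl).mul (mem_forms.1 hg)
    constructor
    · rw [homogeneousComponent_of_mem h1]
      by_cases hb : b = 0
      · subst hb
        rw [if_pos (by simp), ← C_apply, coeff_zero_C, smul_eq_C_mul]
      · have : b.degree ≠ 0 := fun h0 => hb ((Finsupp.degree_eq_zero_iff b).1 h0)
        classical
        rw [if_neg (by omega), coeff_monomial, if_neg hb, zero_smul]
    · intro i hi
      rw [homogeneousComponent_of_mem h1, if_neg (by omega)]

theorem homogeneousComponent_mem_orbitSpan {V : Submodule k (MvPolynomial (Fin n) k)}
    (hV : V ≤ forms k n d) {p : MvPolynomial (Fin n) k} (hp : p ∈ symSpan V) :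
    homogeneousComponent d p ∈ orbitSpan V ∧ ∀ i < d, homogeneousComponent i p = 0 := by
  -- Quantifying over all multiples lets the induction pass through multiplication by ring elements.
  suffices h : ∀ a, homogeneousComponent d (a * p) ∈ orbitSpan V ∧
      ∀ i < d, homogeneousComponent i (a * p) = 0 by simpa using h 1
  induction hp using Submodule.span_induction with
  | mem x hx =>
    obtain ⟨σ, f, hf, rfl⟩ := hx
    intro a
    have h1 := homogeneousComponent_mul_of_mem_forms (rename_mem_forms (hV hf) σ) a
    refine ⟨?_, h1.2⟩
    rw [h1.1]
    exact Submodule.smul_mem _ _ (rename_mem_orbitSpan hf σ)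
  | zero => intro a; simp
  | add x y _ _ hx hy =>
    intro a
    refine ⟨?_, fun i hi => ?_⟩
    · rw [mul_add, map_add]
      exact Submodule.add_mem _ (hx a).1 (hy a).1
    · rw [mul_add, map_add, (hx a).2 i hi, (hy a).2 i hi, add_zero]
  | smul c x _ hx =>
    intro a
    rw [smul_eq_mul, ← mul_assoc]
    exact hx _

theorem orbitSpan_le_symSpan (V : Submodule k (MvPolynomial (Fin n) k)) :
    orbitSpan V ≤ (symSpan V).restrictScalars k :=
  Submodule.span_le.2 fun _ hg => Ideal.subset_span hg

theorem symSpan_inf_forms {V : Submodule k (MvPolynomial (Fin n) k)} (hV : V ≤ forms k n d) :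
    (symSpan V).restrictScalars k ⊓ forms k n d = orbitSpan V := by
  apply le_antisymm
  · rintro p ⟨hp, hpd⟩
    have h1 := (homogeneousComponent_mem_orbitSpan hV hp).1
    rwa [homogeneousComponent_of_mem hpd, if_pos rfl] at h1
  · exact le_inf (orbitSpan_le_symSpan V) (orbitSpan_le_forms hV)

theorem symSpan_inf_forms_of_lt {V : Submodule k (MvPolynomial (Fin n) k)} (hV : V ≤ forms k n d)
    {i : ℕ} (hi : i < d) : (symSpan V).restrictScalars k ⊓ forms k n i = ⊥ := by
  rw [eq_bot_iff]
  rintro p ⟨hp, hpi⟩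
  have h1 := (homogeneousComponent_mem_orbitSpan hV hp).2 i hi
  rwa [homogeneousComponent_of_mem hpi, if_pos rfl] at h1

theorem orbitSpan_span {r : ℕ} (v : Fin r → MvPolynomial (Fin n) k) :
    orbitSpan (Submodule.span k (Set.range v)) =
      Submodule.span k (Set.range fun σj : Equiv.Perm (Fin n) × Fin r =>
        rename σj.1 (v σj.2)) := by
  apply le_antisymm
  · refine Submodule.span_le.2 ?_
    rintro _ ⟨σ, f, hf, rfl⟩
    have h1 := Submodule.mem_map_of_mem (f := (rename (R := k) σ).toLinearMap) hf
    rw [Submodule.map_span] at h1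
    refine Submodule.span_mono ?_ h1
    rintro _ ⟨_, ⟨j, rfl⟩, rfl⟩
    exact ⟨(σ, j), rfl⟩
  · refine Submodule.span_le.2 ?_
    rintro _ ⟨⟨σ, j⟩, rfl⟩
    exact rename_mem_orbitSpan (Submodule.subset_span (Set.mem_range_self j)) σ

theorem alpha_span {r : ℕ} (v : Fin r → MvPolynomial (Fin n) k) :
    alpha (Submodule.span k (Set.range v)) =
      Submodule.span k (Set.range fun j => reynolds k n (v j)) := by
  rw [alpha, Submodule.map_span, ← Set.range_comp]
  rfl

theorem alpha_le_invForms {V : Submodule k (MvPolynomial (Fin n) k)} (hV : V ≤ forms k n d) :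
    alpha V ≤ invForms k n d := by
  rintro _ ⟨f, hf, rfl⟩
  exact reynolds_mem_invForms (hV hf)

theorem alpha_le_orbitSpan (V : Submodule k (MvPolynomial (Fin n) k)) :
    alpha V ≤ orbitSpan V := by
  rintro _ ⟨f, hf, rfl⟩
  rw [reynolds_apply]
  exact Submodule.smul_mem _ _ (Submodule.sum_mem _ fun σ _ => rename_mem_orbitSpan hf σ)

section Open

variable {r : ℕ}

theorem IsOpenCondition.congr {C D : (Fin r → MvPolynomial (Fin n) k) → Prop}
    (hC : IsOpenCondition r d C) (h : ∀ v, (∀ j, v j ∈ forms k n d) → (C v ↔ D v)) :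
    IsOpenCondition r d D := by
  obtain ⟨F, hF⟩ := hC
  exact ⟨F, fun v hv => (h v hv).symm.trans (hF v hv)⟩

theorem isOpenCondition_orbitSpan (m : ℕ) :
    IsOpenCondition (k := k) (n := n) r d (fun v =>
      m ≤ Module.finrank k (orbitSpan (Submodule.span k (Set.range v)))) := by
  refine (isOpenCondition_rank (ι := Equiv.Perm (Fin n) × Fin r) m
    (fun σj v => rename σj.1 (v σj.2)) (fun σj φ => ?_) fun v hv => ?_).congr fun v _ => ?_
  · exact IsPolynomialFun.linear (φ ∘ₗ (rename (R := k) σj.1).toLinearMap) σj.2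
  · exact FiniteDimensional.span_of_finite k (Set.finite_range _)
  · rw [orbitSpan_span]

theorem isOpenCondition_alpha_sup (m : ℕ) (E : Submodule k (MvPolynomial (Fin n) k))
    [FiniteDimensional k E] :
    IsOpenCondition (k := k) (n := n) r d (fun v =>
      m ≤ Module.finrank k ↥(alpha (Submodule.span k (Set.range v)) ⊔ E)) := by
  let u : Fin r ⊕ E → (Fin r → MvPolynomial (Fin n) k) → MvPolynomial (Fin n) k := fun i v =>
    Sum.elim (fun j => reynolds k n (v j)) (fun e => e.1) i
  have hspan : ∀ v : Fin r → MvPolynomial (Fin n) k, Submodule.span k (Set.range fun i => u i v) =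
      alpha (Submodule.span k (Set.range v)) ⊔ E := by
    intro v
    rw [alpha_span]
    apply le_antisymm
    · refine Submodule.span_le.2 ?_
      rintro _ ⟨j | e, rfl⟩
      · exact Submodule.mem_sup_left (Submodule.subset_span (Set.mem_range_self j))
      · exact Submodule.mem_sup_right e.2
    · refine sup_le (Submodule.span_mono ?_) fun e he => ?_
      · rintro _ ⟨j, rfl⟩
        exact ⟨Sum.inl j, rfl⟩
      · exact Submodule.subset_span ⟨Sum.inr ⟨e, he⟩, rfl⟩
  refine (isOpenCondition_rank m u (fun i φ => ?_) fun v _ => ?_).congr fun v _ => ?_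
  · rcases i with j | e
    · exact IsPolynomialFun.linear (φ ∘ₗ reynolds k n) j
    · exact IsPolynomialFun.const (φ e.1)
  · rw [hspan, alpha_span]
    have := FiniteDimensional.span_of_finite k
      (Set.finite_range fun j => reynolds k n (v j))
    infer_instance
  · rw [hspan]

theorem exists_coeffSum_ne_zero_iff (hf : (n.factorial : k) ≠ 0)
    (v : Fin r → MvPolynomial (Fin n) k) :
    (∃ u ∈ alpha (Submodule.span k (Set.range v)), coeffSum k n u ≠ 0) ↔
      ∃ j, coeffSum k n (v j) ≠ 0 := by
  constructor
  · rintro ⟨_, ⟨f, hfv, rfl⟩, hu⟩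
    rw [coeffSum_reynolds hf] at hu
    by_contra hcon
    push Not at hcon
    refine hu ?_
    have : Submodule.span k (Set.range v) ≤ LinearMap.ker (coeffSum k n) := by
      refine Submodule.span_le.2 ?_
      rintro _ ⟨j, rfl⟩
      exact hcon j
    exact this hfv
  · rintro ⟨j, hj⟩
    refine ⟨reynolds k n (v j), ⟨v j, Submodule.subset_span ⟨j, rfl⟩, rfl⟩, ?_⟩
    rwa [coeffSum_reynolds hf]

theorem span_mem_Gr {M : Submodule k (MvPolynomial (Fin n) k)}
    {v : Fin r → MvPolynomial (Fin n) k} (hv : ∀ j, v j ∈ M) (hli : LinearIndependent k v) :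
    Submodule.span k (Set.range v) ∈ Gr r M := by
  refine ⟨Submodule.span_le.2 ?_, ?_⟩
  · rintro _ ⟨j, rfl⟩
    exact hv j
  · rw [finrank_span_eq_card hli, Fintype.card_fin]

theorem mem_OTilde_iff {V : Submodule k (MvPolynomial (Fin n) k)} :
    V ∈ OTilde k n r d ↔ V ∈ Gr r (forms k n d) ∧
      Module.finrank k (forms k n d) - (P d - r) ≤ Module.finrank k (orbitSpan V) := by
  rw [OTilde, Set.mem_ofPred_eq]
  refine and_congr_right fun hV => ?_
  rw [symSpan_inf_forms hV.1]
  omega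

theorem isZariskiOpen_O (hf : (n.factorial : k) ≠ 0) (hd : 0 < d) (hdn : d < n) :
    IsZariskiOpen r (forms k n d) (O k n r d) := by
  refine ⟨fun V hV => hV.1.1, ?_⟩
  have hE : FiniteDimensional k (sumXMultiples k n d) :=
    Submodule.finiteDimensional_of_le (sumXMultiples_le hd)
  have hOT := isOpenCondition_orbitSpan (k := k) (n := n) (d := d) (r := r)
    (Module.finrank k (forms k n d) - (P d - r))
  rcases lt_or_ge r (P d) with hr | hr
  · have h2 := (isOpenCondition_alpha_sup (k := k) (n := n) (d := d) (r := r) r ⊥).and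
      ((IsOpenCondition.exists fun j => (IsPolynomialFun.linear (d := d) (coeffSum k n)
        j).isOpenCondition).and (isOpenCondition_alpha_sup (k := k) (n := n) (d := d) (r := r)
          (min (P d) (P (d - 1) + r)) (sumXMultiples k n d)))
    obtain ⟨F, hF⟩ := hOT.and h2
    refine ⟨F, fun v hv hli => (Iff.trans ?_ (hF v hv))⟩
    have hGr := span_mem_Gr hv hli
    beta_reduce
    rw [O, Set.mem_ofPred_eq, mem_OTilde_iff, and_iff_right hGr, imp_iff_right hr,
      mem_G_iff hf hd hdn, exists_coeffSum_ne_zero_iff hf, sup_bot_eq]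
    refine and_congr_right fun _ => and_congr_left fun _ => ?_
    have hle : Module.finrank k (alpha (Submodule.span k (Set.range v))) ≤ r := by
      rw [alpha_span]
      exact (finrank_range_le_card _).trans_eq (Fintype.card_fin r)
    exact ⟨fun h => h.2.ge, fun h => ⟨alpha_le_invForms hGr.1, hle.antisymm h⟩⟩
  · obtain ⟨F, hF⟩ := hOT
    refine ⟨F, fun v hv hli => (Iff.trans ?_ (hF v hv))⟩
    rw [O, Set.mem_ofPred_eq, mem_OTilde_iff, and_iff_right (span_mem_Gr hv hli)]
    exact and_iff_left fun h => absurd h (not_lt.2 hr)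

end Open

end SymIdeal

end

/-! ### Minimality of the Hilbert function -/

noncomputable section

namespace SymIdeal

variable {k : Type*} [Field k] {n d r : ℕ}

theorem finrank_map_add_finrank_inf_ker {E F : Type*} [AddCommGroup E] [Module k E]
    [AddCommGroup F] [Module k F] (φ : E →ₗ[k] F) (X : Submodule k E) [FiniteDimensional k X] :
    Module.finrank k (X.map φ) + Module.finrank k ↥(X ⊓ LinearMap.ker φ) =
      Module.finrank k X := by
  have h1 := LinearMap.finrank_range_add_finrank_ker (φ.domRestrict X)
  have h2 : LinearMap.range (φ.domRestrict X) = X.map φ := by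
    rw [LinearMap.domRestrict, LinearMap.range_comp, Submodule.range_subtype]
  have h3 : LinearMap.ker (φ.domRestrict X) = (X ⊓ LinearMap.ker φ).submoduleOf X := by
    ext ⟨x, hx⟩
    simp [Submodule.submoduleOf]
  rw [h2, h3, (Submodule.submoduleOfEquivOfLe inf_le_left).finrank_eq] at h1
  exact h1

theorem hilbertFunction_add (I : Ideal (MvPolynomial (Fin n) k)) (i : ℕ) :
    hilbertFunction I i +
      Module.finrank k ↥(I.restrictScalars k ⊓ forms k n i) =
    Module.finrank k (forms k n i) := by
  have h := finrank_map_add_finrank_inf_ker (Ideal.Quotient.mkₐ k I).toLinearMap (forms k n i)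
  have h1 : LinearMap.ker (Ideal.Quotient.mkₐ k I).toLinearMap = I.restrictScalars k := by
    ext x
    exact Ideal.Quotient.eq_zero_iff_mem
  rw [h1, inf_comm] at h
  exact h

theorem map_reynolds_forms (hf : (n.factorial : k) ≠ 0) :
    (forms k n d).map (reynolds k n) = invForms k n d := by
  apply le_antisymm
  · rintro _ ⟨f, hf', rfl⟩
    exact reynolds_mem_invForms hf'
  · exact fun f h => ⟨f, invForms_le_forms k n d h, reynolds_eq_self hf h⟩

theorem finrank_forms_inf_ker (hf : (n.factorial : k) ≠ 0) (hdn : d ≤ n) :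
    P d + Module.finrank k ↥(forms k n d ⊓ LinearMap.ker (reynolds k n)) =
      Module.finrank k (forms k n d) := by
  rw [← finrank_map_add_finrank_inf_ker (reynolds k n) (forms k n d), map_reynolds_forms hf,
    finrank_invForms hdn]

/-- Rank-nullity for `ρ` on the orbit span, whose image is no larger than the image of `V`. -/
theorem finrank_orbitSpan_le {V : Submodule k (MvPolynomial (Fin n) k)}
    (hV : V ∈ Gr r (forms k n d)) :
    Module.finrank k (orbitSpan V) ≤
      r + Module.finrank k ↥(orbitSpan V ⊓ LinearMap.ker (reynolds k n)) := by
  have := Submodule.finiteDimensional_of_le (orbitSpan_le_forms hV.1)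
  have : FiniteDimensional k V := Submodule.finiteDimensional_of_le hV.1
  rw [← finrank_map_add_finrank_inf_ker (reynolds k n) (orbitSpan V)]
  refine Nat.add_le_add_right ?_ _
  have h1 : (orbitSpan V).map (reynolds k n) ≤ V.map (reynolds k n) := by
    rw [orbitSpan, Submodule.map_span, Submodule.span_le]
    rintro _ ⟨_, ⟨σ, f, hf, rfl⟩, rfl⟩
    exact ⟨f, hf, (reynolds_rename σ f).symm⟩
  rw [← hV.2]
  exact (Submodule.finrank_mono h1).trans (Submodule.finrank_map_le _ _)

theorem finrank_orbitSpan_add_le (hf : (n.factorial : k) ≠ 0) (hdn : d ≤ n)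
    {V : Submodule k (MvPolynomial (Fin n) k)} (hV : V ∈ Gr r (forms k n d)) :
    Module.finrank k (orbitSpan V) + P d ≤ Module.finrank k (forms k n d) + r := by
  have h1 := finrank_orbitSpan_le hV
  have : FiniteDimensional k ↥(forms k n d ⊓ LinearMap.ker (reynolds k n)) :=
    Submodule.finiteDimensional_of_le inf_le_left
  have h2 := Submodule.finrank_mono
    (inf_le_inf_right (LinearMap.ker (reynolds k n)) (orbitSpan_le_forms hV.1))
  have h3 := finrank_forms_inf_ker hf hdn
  omega

/-- Membership in `OTilde` is equality in the dimension bound, which forces the orbit span to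
contain the whole kernel of `ρ` in degree `d`. -/
theorem forms_inf_ker_le_orbitSpan (hf : (n.factorial : k) ≠ 0) (hdn : d ≤ n)
    {V : Submodule k (MvPolynomial (Fin n) k)} (hV : V ∈ OTilde k n r d) (hr : r ≤ P d) :
    forms k n d ⊓ LinearMap.ker (reynolds k n) ≤ orbitSpan V := by
  obtain ⟨hG, hV⟩ := mem_OTilde_iff.1 hV
  have h1 := finrank_orbitSpan_le hG
  have h3 := finrank_forms_inf_ker hf hdn
  have : FiniteDimensional k ↥(forms k n d ⊓ LinearMap.ker (reynolds k n)) :=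
    Submodule.finiteDimensional_of_le inf_le_left
  have h2 := Submodule.eq_of_le_of_finrank_le
    (inf_le_inf_right (LinearMap.ker (reynolds k n)) (orbitSpan_le_forms hG.1)) (by omega)
  rw [← h2]
  exact inf_le_left

theorem forms_le_of_le {I : Ideal (MvPolynomial (Fin n) k)} {m i : ℕ}
    (h : forms k n m ≤ I.restrictScalars k) (hmi : m ≤ i) :
    forms k n i ≤ I.restrictScalars k := by
  intro f hf
  rw [form_eq_sum hf]
  refine Submodule.sum_mem _ fun a _ => Submodule.smul_mem _ _ ?_
  obtain ⟨e, he, hed⟩ := Finsupp.exists_le_degree_eq a.1 m (hmi.trans_eq a.2.symm)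
  have h1 : (monomial a.1 (1 : k)) = monomial (a.1 - e) 1 * monomial e 1 := by
    rw [monomial_mul, tsub_add_cancel_of_le he, one_mul]
  rw [h1]
  exact Ideal.mul_mem_left I _ (h (isHomogeneous_monomial (1 : k) hed))

theorem exists_ne_ne_ne (hn : 3 ≤ n) (i : Fin n) : ∃ j l : Fin n, j ≠ i ∧ l ≠ i ∧ j ≠ l := by
  have h : 1 < (Finset.univ.erase i).card := by
    rw [Finset.card_erase_of_mem (Finset.mem_univ i), Finset.card_univ, Fintype.card_fin]
    omega
  obtain ⟨j, hj, l, hl, hjl⟩ := Finset.one_lt_card.1 h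
  exact ⟨j, l, Finset.ne_of_mem_erase hj, Finset.ne_of_mem_erase hl, hjl⟩

/-- Modulo `I` the class of `x_i x^b` turns out not to depend on `b`, so `x_i u` is the coefficient
sum of `u` times this class. -/
theorem forms_succ_le (hn : 3 ≤ n) {I : Ideal (MvPolynomial (Fin n) k)}
    (hker : forms k n d ⊓ LinearMap.ker (reynolds k n) ≤ I.restrictScalars k)
    {u : MvPolynomial (Fin n) k} (huI : u ∈ I) (hud : u ∈ forms k n d)
    (hu : coeffSum k n u ≠ 0) : forms k n (d + 1) ≤ I.restrictScalars k := by
  let m : (Fin n →₀ ℕ) → MvPolynomial (Fin n) k ⧸ I :=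
    fun a => Ideal.Quotient.mk I (monomial a 1)
  have hm : ∀ (i : Fin n) (a : Fin n →₀ ℕ) (σ : Equiv.Perm (Fin n)), a.degree = d →
      m (a.mapDomain σ + Finsupp.single i 1) = m (a + Finsupp.single i 1) := by
    intro i a σ ha
    refine Ideal.Quotient.eq.2 ?_
    have h1 : (monomial (a.mapDomain σ) (1 : k) - monomial a 1) ∈ I := by
      refine hker ⟨Submodule.sub_mem _
        (isHomogeneous_monomial _ ((degree_mapDomain_perm σ a).trans ha))
        (isHomogeneous_monomial _ ha), ?_⟩
      change reynolds k n _ = 0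
      rw [map_sub, ← rename_monomial, reynolds_rename, sub_self]
    have h2 := Ideal.mul_mem_right (X i) I h1
    rwa [sub_mul, X, monomial_mul, monomial_mul, one_mul] at h2
  -- With `σ = (j l)`: `x_i x_j x^e ≡ x_i x_j x^{σe}` by permuting the factor `x_i x^e`, and this is
  -- `≡ x_i x_l x^e` by permuting `x_l x^e`.
  have hdist : ∀ (i j l : Fin n) (e : Fin n →₀ ℕ), e.degree + 1 = d → j ≠ i → l ≠ i →
      m (e + Finsupp.single j 1 + Finsupp.single i 1) =
        m (e + Finsupp.single l 1 + Finsupp.single i 1) := by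
    intro i j l e he hj hl
    have h1 := hm j (e + Finsupp.single i 1) (Equiv.swap j l)
      (by rw [map_add, Finsupp.degree_single, he])
    have h2 := hm i (e + Finsupp.single l 1) (Equiv.swap j l)
      (by rw [map_add, Finsupp.degree_single, he])
    rw [Finsupp.mapDomain_add, Finsupp.mapDomain_single] at h1 h2
    rw [Equiv.swap_apply_of_ne_of_ne hj.symm hl.symm] at h1
    rw [Equiv.swap_apply_right] at h2
    rw [← h2, add_right_comm, ← h1, add_right_comm]
  have hall : ∀ (i : Fin n) (e : Fin n →₀ ℕ), e.degree + 1 = d → ∀ j l,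
      m (e + Finsupp.single j 1 + Finsupp.single i 1) =
        m (e + Finsupp.single l 1 + Finsupp.single i 1) := by
    intro i e he j l
    rcases eq_or_ne j l with rfl | hjl
    · rfl
    -- The case where `j` or `l` equals `i` is reduced to the previous one by moving both away from
    -- `i`; this needs three variables.
    obtain ⟨j', l', hj', hl', hjl'⟩ := exists_ne_ne_ne hn i
    obtain ⟨τ, rfl, rfl⟩ := exists_perm_map_pair hjl hjl'
    have h1 : ∀ x, m ((e + Finsupp.single x 1).mapDomain τ + Finsupp.single i 1) =
        m (e + Finsupp.single x 1 + Finsupp.single i 1) :=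
      fun x => hm i _ τ (by rw [map_add, Finsupp.degree_single, he])
    rw [← h1 j, ← h1 l, Finsupp.mapDomain_add, Finsupp.mapDomain_add, Finsupp.mapDomain_single,
      Finsupp.mapDomain_single]
    exact hdist i _ _ _ (by rw [degree_mapDomain_perm, he]) hj' hl'
  have hzero : ∀ (i : Fin n) (b : Fin n →₀ ℕ), b.degree = d → m (b + Finsupp.single i 1) = 0 := by
    intro i b hb
    have hconst : ∀ a : DegExp n d, m (a.1 + Finsupp.single i 1) = m (b + Finsupp.single i 1) :=
      fun a => eq_of_shift_eq d (fun a => m (a + Finsupp.single i 1)) (hall i) a.1 b a.2 hb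
    have h1 : Ideal.Quotient.mkₐ k I (u * X i) = 0 :=
      Ideal.Quotient.eq_zero_iff_mem.2 (Ideal.mul_mem_right _ _ huI)
    have h2 : ∀ a : DegExp n d,
        Ideal.Quotient.mkₐ k I (coeff a.1 u • monomial a.1 (1 : k) * X i) =
          coeff a.1 u • m (b + Finsupp.single i 1) := by
      intro a
      rw [smul_mul_assoc, map_smul, ← hconst a, X, monomial_mul, one_mul]
      rfl
    have h3 : coeffSum k n u = ∑ a : DegExp n d, coeff a.1 u := by
      conv_lhs => rw [form_eq_sum hud]
      rw [map_sum]
      refine Finset.sum_congr rfl fun a _ => ?_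
      rw [map_smul, coeffSum_monomial, smul_eq_mul, mul_one]
    rw [form_eq_sum hud, Finset.sum_mul, map_sum, Finset.sum_congr rfl fun a _ => h2 a,
      ← Finset.sum_smul, ← h3] at h1
    exact (smul_eq_zero.1 h1).resolve_left hu
  intro f hf
  rw [form_eq_sum hf]
  refine Submodule.sum_mem _ fun a _ => Submodule.smul_mem _ _ ?_
  obtain ⟨i, hi⟩ : ∃ i, a.1 i ≠ 0 := by
    by_contra hcon
    push Not at hcon
    have h1 := a.2
    rw [show a.1 = 0 from Finsupp.ext hcon, map_zero] at h1
    omega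
  have hle : Finsupp.single i 1 ≤ a.1 := by
    rw [Finsupp.single_le_iff]; omega
  have h1 := congrArg Finsupp.degree (tsub_add_cancel_of_le hle)
  rw [map_add, Finsupp.degree_single, a.2] at h1
  have h2 := hzero i (a.1 - Finsupp.single i 1) (by omega)
  rw [tsub_add_cancel_of_le hle] at h2
  exact Ideal.Quotient.eq_zero_iff_mem.1 h2

theorem P_one : P 1 = 1 := Fintype.card_unique

theorem hilbertFunction_le (hf : (n.factorial : k) ≠ 0) (hr : 0 < r) (hd : 0 < d) (hdn : d < n)
    {V V' : Submodule k (MvPolynomial (Fin n) k)} (hV : V ∈ O k n r d)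
    (hV' : V' ∈ Gr r (forms k n d)) (i : ℕ) :
    hilbertFunction (symSpan V) i ≤ hilbertFunction (symSpan V') i := by
  have hI := hilbertFunction_add (symSpan V) i
  have hJ := hilbertFunction_add (symSpan V') i
  obtain ⟨hG, hdim⟩ := mem_OTilde_iff.1 hV.1
  rcases lt_trichotomy i d with hi | rfl | hi
  · rw [symSpan_inf_forms_of_lt hV'.1 hi, finrank_bot] at hJ
    omega
  · rw [symSpan_inf_forms hV'.1] at hJ
    rw [symSpan_inf_forms hG.1] at hI
    have h1 := finrank_orbitSpan_add_le hf hdn.le hV'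
    omega
  · suffices h : forms k n (d + 1) ≤ (symSpan V).restrictScalars k by
      rw [inf_eq_right.2 (forms_le_of_le h hi)] at hI
      omega
    rcases lt_or_ge r (P d) with hrP | hrP
    · obtain ⟨-, ⟨u, huU, hu⟩, -⟩ := (mem_G_iff hf hd hdn).1 (hV.2 hrP)
      -- As `0 < r < P d` and `P 1 = 1`, the degree is at least `2`, so `n ≥ 3`.
      have hd1 : d ≠ 1 := by
        rintro rfl
        rw [P_one] at hrP
        omega
      exact forms_succ_le (by omega)
        ((forms_inf_ker_le_orbitSpan hf hdn.le hV.1 hrP.le).trans (orbitSpan_le_symSpan V))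
        (orbitSpan_le_symSpan V (alpha_le_orbitSpan V huU))
        (orbitSpan_le_forms hG.1 (alpha_le_orbitSpan V huU)) hu
    · have h1 : orbitSpan V = forms k n d :=
        Submodule.eq_of_le_of_finrank_le (orbitSpan_le_forms hG.1) (by omega)
      exact forms_le_of_le (h1 ▸ orbitSpan_le_symSpan V) (Nat.le_succ d)

end SymIdeal

end

/-! ### Linear algebra in general position and nonemptiness of `G` -/

noncomputable section

namespace SymIdeal

section LinearAlgebra

variable {k M : Type*} [Field k] [AddCommGroup M] [Module k M]

theorem finrank_span_singleton_le (b : M) : Module.finrank k (Submodule.span k {b}) ≤ 1 := by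
  have := finrank_span_finset_le_card (R := k) ({b} : Finset M)
  rwa [Finset.coe_singleton, Finset.card_singleton] at this

theorem exists_between_finrank_eq [FiniteDimensional k M] {A B : Submodule k M} (hAB : A ≤ B)
    {r : ℕ} (hA : Module.finrank k A ≤ r) (hB : r ≤ Module.finrank k B) :
    ∃ U, A ≤ U ∧ U ≤ B ∧ Module.finrank k U = r := by
  induction r, hA using Nat.le_induction with
  | base => exact ⟨A, le_rfl, hAB, rfl⟩
  | succ r _ ih =>
    obtain ⟨U, hAU, hUB, hU⟩ := ih (by omega)
    have hlt : U < B := lt_of_le_of_ne hUB fun h => by rw [← h] at hB; omega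
    obtain ⟨b, hbB, hbU⟩ := SetLike.exists_of_lt hlt
    refine ⟨U ⊔ Submodule.span k {b}, hAU.trans le_sup_left,
      sup_le hUB ((Submodule.span_singleton_le_iff_mem _ _).2 hbB), ?_⟩
    apply le_antisymm
    · refine (Submodule.finrank_add_le_finrank_add_finrank _ _).trans ?_
      rw [hU]
      exact Nat.add_le_add_left (finrank_span_singleton_le b) r
    · rw [← hU]
      refine Submodule.finrank_lt_finrank_of_lt (lt_of_le_of_ne le_sup_left fun h => hbU ?_)
      rw [h]
      exact Submodule.mem_sup_right (Submodule.mem_span_singleton_self b)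

/-- Take a complement `C` of `E` through a vector with `φ ≠ 0`, and choose `U` inside `C` or
containing `C` according to `r`. -/
theorem exists_submodule_general_position [FiniteDimensional k M] (E : Submodule k M)
    (φ : M →ₗ[k] k) {u₀ : M} (hu₀ : u₀ ∈ E) (hφ : φ u₀ ≠ 0) {r : ℕ} (hr : 0 < r)
    (hrM : r ≤ Module.finrank k M) :
    ∃ U : Submodule k M, Module.finrank k U = r ∧ (∃ u ∈ U, φ u ≠ 0) ∧
      min (Module.finrank k M) (Module.finrank k E + r) ≤ Module.finrank k ↥(U ⊔ E) := by
  by_cases hE : E = ⊤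
  · obtain ⟨U, hU, -, hUr⟩ := exists_between_finrank_eq (A := Submodule.span k {u₀}) (B := ⊤)
      le_top (r := r) ((finrank_span_singleton_le u₀).trans hr) (by rwa [finrank_top])
    refine ⟨U, hUr, ⟨u₀, hU (Submodule.mem_span_singleton_self u₀), hφ⟩, ?_⟩
    rw [hE, sup_top_eq, finrank_top]
    exact min_le_left _ _
  -- If `φ` vanishes at a vector outside `E`, adding `u₀ ∈ E` repairs this without entering `E`.
  · obtain ⟨u, huE, hu⟩ : ∃ u, u ∉ E ∧ φ u ≠ 0 := by
      obtain ⟨u, -, hu⟩ := SetLike.exists_of_lt (lt_top_iff_ne_top.2 hE)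
      by_cases h : φ u = 0
      · refine ⟨u + u₀, fun h' => hu ?_, by rwa [map_add, h, zero_add]⟩
        simpa using E.sub_mem h' hu₀
      · exact ⟨u, hu, h⟩
    have hdisj : Disjoint (Submodule.span k {u}) E := by
      rw [Submodule.disjoint_def]
      intro x hx hxE
      obtain ⟨c, rfl⟩ := Submodule.mem_span_singleton.1 hx
      by_contra hne
      exact huE ((E.smul_mem_iff (left_ne_zero_of_smul hne)).1 hxE)
    obtain ⟨C, huC, hC⟩ := hdisj.exists_isCompl
    have hdim := Submodule.finrank_add_eq_of_isCompl hC
    have hmem : u ∈ C := huC (Submodule.mem_span_singleton_self u)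
    rcases le_total r (Module.finrank k C) with h | h
    · obtain ⟨U, hU, hUC, hUr⟩ := exists_between_finrank_eq huC
        (r := r) ((finrank_span_singleton_le u).trans hr) h
      refine ⟨U, hUr, ⟨u, hU (Submodule.mem_span_singleton_self u), hu⟩, ?_⟩
      have h1 := Submodule.finrank_sup_add_finrank_inf_eq U E
      rw [(hC.disjoint.mono_left hUC).eq_bot, finrank_bot] at h1
      omega
    · obtain ⟨U, hU, -, hUr⟩ := exists_between_finrank_eq (A := C) (B := ⊤)
        le_top h (by rwa [finrank_top])
      refine ⟨U, hUr, ⟨u, hU hmem, hu⟩, ?_⟩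
      have h1 : U ⊔ E = ⊤ := top_le_iff.1 (hC.sup_eq_top.ge.trans (sup_le_sup_right hU E))
      rw [h1, finrank_top]
      exact min_le_left _ _

theorem exists_fun_span_eq (U : Submodule k M) [FiniteDimensional k U] {r : ℕ}
    (hU : Module.finrank k U ≤ r) : ∃ h : Fin r → M, Submodule.span k (Set.range h) = U := by
  let b := Module.finBasis k U
  let h : Fin r → M := fun j =>
    if hj : (j : ℕ) < Module.finrank k U then (b ⟨j, hj⟩ : M) else 0
  refine ⟨h, le_antisymm (Submodule.span_le.2 ?_) fun u hu => ?_⟩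
  · rintro _ ⟨j, rfl⟩
    simp only [h]
    split_ifs
    · exact Subtype.prop _
    · exact U.zero_mem
  · have h1 : u = ∑ i, b.repr ⟨u, hu⟩ i • (b i : M) := by
      have h2 := congrArg U.subtype (b.sum_repr ⟨u, hu⟩)
      rw [map_sum] at h2
      exact h2.symm
    rw [h1]
    refine Submodule.sum_mem _ fun i _ => Submodule.smul_mem _ _ (Submodule.subset_span
      ⟨Fin.castLE hU i, ?_⟩)
    simp [h]

end LinearAlgebra

variable {k : Type*} [Field k] {n d r : ℕ}

/-- The vector `u₀` needed for general position is `e_1^d`, whose coefficient sum `n^d` is nonzero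
in `k`. -/
theorem G_nonempty (hf : (n.factorial : k) ≠ 0) (hr : 0 < r) (hd : 0 < d) (hdn : d < n)
    (hrP : r ≤ P d) : (G k n r d).Nonempty := by
  have hn0 : (n : k) ≠ 0 :=
    natCast_ne_zero_of_dvd_factorial hf (Nat.dvd_factorial (by omega) le_rfl)
  have hpow : ∀ e, sumX k n ^ e ∈ invForms k n e := by
    intro e
    induction e with
    | zero =>
      rw [pow_zero, mem_invForms]
      exact ⟨fun σ => map_one _, isHomogeneous_one _ _⟩
    | succ e ih => rw [pow_succ]; exact mul_mem_invForms ih sumX_mem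
  have hmem : sumX k n ^ d ∈ sumXMultiples k n d := by
    refine ⟨sumX k n ^ (d - 1), hpow _, ?_⟩
    change sumX k n ^ (d - 1) * sumX k n = _
    rw [← pow_succ, Nat.sub_add_cancel hd]
  have hcs : coeffSum k n (sumX k n ^ d) ≠ 0 := by
    have h1 : coeffSum k n (sumX k n ^ d) = coeffSum k n (sumX k n) ^ d := map_pow (aeval _) _ _
    rw [h1, coeffSum_sumX]
    exact pow_ne_zero _ hn0
  have hle := sumXMultiples_le (k := k) (n := n) hd
  obtain ⟨U, hU, ⟨u, huU, hu⟩, hmin⟩ := exists_submodule_general_position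
    ((sumXMultiples k n d).submoduleOf (invForms k n d))
    (coeffSum k n ∘ₗ (invForms k n d).subtype) (u₀ := ⟨sumX k n ^ d, hle hmem⟩) hmem hcs hr
    (by rwa [finrank_invForms hdn.le])
  have hmap : ∀ W : Submodule k (invForms k n d),
      Module.finrank k (W.map (invForms k n d).subtype) = Module.finrank k W := fun W =>
    (Submodule.equivMapOfInjective _ (Submodule.subtype_injective _) W).finrank_eq.symm
  refine ⟨U.map (invForms k n d).subtype, (mem_G_iff hf hd hdn).2
    ⟨⟨Submodule.map_subtype_le _ _, (hmap U).trans hU⟩, ⟨u, ⟨u, huU, rfl⟩, hu⟩, ?_⟩⟩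
  have h1 : ((sumXMultiples k n d).submoduleOf (invForms k n d)).map (invForms k n d).subtype =
      sumXMultiples k n d := by
    rw [Submodule.submoduleOf, Submodule.map_comap_subtype, inf_eq_right.2 hle]
  rw [finrank_invForms hdn.le, (Submodule.submoduleOfEquivOfLe hle).finrank_eq,
    finrank_sumXMultiples (by omega), finrank_invForms (by omega), ← hmap, Submodule.map_sup,
    h1] at hmin
  exact hmin

theorem finrank_forms : (n + d - 1).choose d ≤ Module.finrank k (forms k n d) := by
  have hcard : Fintype.card (DegExp n d) = (n + d - 1).choose d := by
    rw [← Fintype.card_congr (β := DegExp n d) (Sym.equivNatSum (Fin n) d),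
      Sym.card_sym_eq_choose, Fintype.card_fin]
  have hli : LinearIndependent k (fun a : DegExp n d => monomial a.1 (1 : k)) := by
    have := (basisMonomials (Fin n) k).linearIndependent.comp (fun a : DegExp n d => a.1)
      Subtype.val_injective
    rwa [coe_basisMonomials] at this
  rw [← hcard, ← finrank_span_eq_card hli]
  refine Submodule.finrank_mono (Submodule.span_le.2 ?_)
  rintro _ ⟨a, rfl⟩
  exact isHomogeneous_monomial _ a.2

/-- Multiplication by `e_1` embeds symmetric forms of degree `i` in those of degree `i + 1`; any
field and enough variables will do. -/
theorem P_le_succ (i : ℕ) : P i ≤ P (i + 1) := by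
  have h1 := Submodule.finrank_mono (sumXMultiples_le (k := ℚ) (n := i + 1) (Nat.succ_pos i))
  rwa [finrank_sumXMultiples (Nat.succ_pos i), finrank_invForms le_rfl,
    finrank_invForms (by omega)] at h1

theorem P_mono : Monotone P := monotone_nat_of_le_succ P_le_succ

end SymIdeal

end

/-! ### Averages over a chain of subgroups, and stabilizers modulo `K` -/

noncomputable section

namespace SymIdeal

variable {k : Type*} [Field k] {n d r : ℕ}

section Average

/-- The subgroup of the permutations that fix every index smaller than `q`. -/
def fixBelow (n q : ℕ) : Subgroup (Equiv.Perm (Fin n)) where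
  carrier := {σ | ∀ i : Fin n, (i : ℕ) < q → σ i = i}
  one_mem' := fun _ _ => rfl
  mul_mem' := fun {σ τ} hσ hτ i hi => by rw [Equiv.Perm.mul_apply, hτ i hi, hσ i hi]
  inv_mem' := fun {σ} hσ i hi => by rw [Equiv.Perm.inv_eq_iff_eq, hσ i hi]

theorem fixBelow_anti {q q' : ℕ} (h : q ≤ q') : fixBelow n q' ≤ fixBelow n q :=
  fun _ hσ i hi => hσ i (lt_of_lt_of_le hi h)

theorem swap_mem_fixBelow {q : ℕ} {i j : Fin n} (hi : q ≤ i) (hj : q ≤ j) :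
    Equiv.swap i j ∈ fixBelow n q := by
  intro l hl
  apply Equiv.swap_apply_of_ne_of_ne <;> rintro rfl <;> omega

theorem fixBelow_zero : fixBelow n 0 = ⊤ :=
  eq_top_iff.2 fun _ _ i hi => absurd hi (Nat.not_lt_zero i)

instance (n q : ℕ) : Fintype (fixBelow n q) := Fintype.ofFinite _

/-- The average over the permutations that fix every index smaller than `q`. -/
def avg (k : Type*) [Field k] (n q : ℕ) : MvPolynomial (Fin n) k →ₗ[k] MvPolynomial (Fin n) k :=
  (Fintype.card (fixBelow n q) : k)⁻¹ •
    ∑ σ : fixBelow n q, (rename (R := k) (σ : Equiv.Perm (Fin n))).toLinearMap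

theorem avg_apply (q : ℕ) (f : MvPolynomial (Fin n) k) :
    avg k n q f = (Fintype.card (fixBelow n q) : k)⁻¹ •
      ∑ σ : fixBelow n q, rename (σ : Equiv.Perm (Fin n)) f := by
  simp [avg]

theorem card_fixBelow_ne_zero (hf : (n.factorial : k) ≠ 0) (q : ℕ) :
    (Fintype.card (fixBelow n q) : k) ≠ 0 := by
  refine natCast_ne_zero_of_dvd_factorial hf ?_
  have h := (fixBelow n q).card_subgroup_dvd_card
  rwa [Nat.card_eq_fintype_card, Nat.card_eq_fintype_card, Fintype.card_perm,
    Fintype.card_fin] at h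

theorem avg_sub_mem (hf : (n.factorial : k) ≠ 0) {q : ℕ} {f : MvPolynomial (Fin n) k}
    {K : Submodule k (MvPolynomial (Fin n) k)} (h : ∀ σ ∈ fixBelow n q, rename σ f - f ∈ K) :
    avg k n q f - f ∈ K := by
  have h1 : avg k n q f - f = (Fintype.card (fixBelow n q) : k)⁻¹ •
      ∑ σ : fixBelow n q, (rename (σ : Equiv.Perm (Fin n)) f - f) := by
    rw [avg_apply, Finset.sum_sub_distrib, smul_sub, Finset.sum_const, Finset.card_univ,
      ← Nat.cast_smul_eq_nsmul k, smul_smul, inv_mul_cancel₀ (card_fixBelow_ne_zero hf q),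
      one_smul]
  rw [h1]
  exact K.smul_mem _ (K.sum_mem fun σ _ => h σ σ.2)

theorem avg_eq_self (hf : (n.factorial : k) ≠ 0) {q : ℕ} {f : MvPolynomial (Fin n) k}
    (h : ∀ σ ∈ fixBelow n q, rename σ f = f) : avg k n q f = f :=
  sub_eq_zero.1 ((Submodule.mem_bot k).1
    (avg_sub_mem hf fun σ hσ => (Submodule.mem_bot k).2 (sub_eq_zero.2 (h σ hσ))))

theorem rename_avg {q : ℕ} {σ : Equiv.Perm (Fin n)} (hσ : σ ∈ fixBelow n q)
    (f : MvPolynomial (Fin n) k) : rename σ (avg k n q f) = avg k n q f := by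
  rw [avg_apply, map_smul, map_sum]
  congr 1
  exact Fintype.sum_equiv (Equiv.mulLeft (⟨σ, hσ⟩ : fixBelow n q)) _ _
    fun τ => (rename_mul_perm σ (τ : Equiv.Perm (Fin n)) f).symm

theorem avg_rename {q : ℕ} {σ : Equiv.Perm (Fin n)} (hσ : σ ∈ fixBelow n q)
    (f : MvPolynomial (Fin n) k) : avg k n q (rename σ f) = avg k n q f := by
  rw [avg_apply, avg_apply]
  congr 1
  exact Fintype.sum_equiv (Equiv.mulRight (⟨σ, hσ⟩ : fixBelow n q)) _ _
    fun τ => (rename_mul_perm (τ : Equiv.Perm (Fin n)) σ f).symm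

theorem avg_avg_of_le (hf : (n.factorial : k) ≠ 0) {q q' : ℕ} (h : q ≤ q')
    (f : MvPolynomial (Fin n) k) : avg k n q' (avg k n q f) = avg k n q f :=
  avg_eq_self hf fun _ hσ => rename_avg (fixBelow_anti h hσ) f

theorem avg_avg_of_ge (hf : (n.factorial : k) ≠ 0) {q q' : ℕ} (h : q ≤ q')
    (f : MvPolynomial (Fin n) k) : avg k n q (avg k n q' f) = avg k n q f := by
  rw [avg_apply q' f, map_smul, map_sum,
    Finset.sum_congr rfl fun σ _ => avg_rename (fixBelow_anti h σ.2) f, Finset.sum_const,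
    Finset.card_univ, ← Nat.cast_smul_eq_nsmul k, smul_smul,
    inv_mul_cancel₀ (card_fixBelow_ne_zero hf q'), one_smul]

theorem avg_zero_eq_reynolds : avg k n 0 = reynolds k n := by
  refine LinearMap.ext fun f => ?_
  rw [avg_apply, reynolds_apply]
  have hcard : Fintype.card (fixBelow n 0) = n.factorial := by
    rw [← Nat.card_eq_fintype_card, fixBelow_zero, Subgroup.card_top, Nat.card_eq_fintype_card,
      Fintype.card_perm, Fintype.card_fin]
  rw [hcard]
  congr 1
  exact Fintype.sum_bijective (fun σ : fixBelow n 0 => (σ : Equiv.Perm (Fin n)))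
    ⟨Subtype.val_injective, fun σ => ⟨⟨σ, fixBelow_zero (n := n) ▸ Subgroup.mem_top σ⟩, rfl⟩⟩
    _ _ fun _ => rfl

/-- The difference of two consecutive averages. -/
def avgDiff (k : Type*) [Field k] (n q : ℕ) :
    MvPolynomial (Fin n) k →ₗ[k] MvPolynomial (Fin n) k :=
  avg k n (q + 1) - avg k n q

/-- The averages over a chain of subgroups are commuting projections with nested images. Their
successive differences are therefore orthogonal idempotents, which isolate the components of a
generator. -/
theorem avgDiff_avgDiff (hf : (n.factorial : k) ≠ 0) (q : ℕ) (f : MvPolynomial (Fin n) k) :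
    avgDiff k n q (avgDiff k n q f) = avgDiff k n q f := by
  simp only [avgDiff, LinearMap.sub_apply, map_sub]
  rw [avg_avg_of_le hf le_rfl, avg_avg_of_le hf (Nat.le_succ q), avg_avg_of_ge hf (Nat.le_succ q),
    avg_avg_of_le hf le_rfl]
  abel

theorem avgDiff_avgDiff_of_ne (hf : (n.factorial : k) ≠ 0) {q q' : ℕ} (h : q ≠ q')
    (f : MvPolynomial (Fin n) k) : avgDiff k n q (avgDiff k n q' f) = 0 := by
  simp only [avgDiff, LinearMap.sub_apply, map_sub]
  rcases lt_or_gt_of_ne h with h | h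
  · rw [avg_avg_of_ge hf (by omega), avg_avg_of_ge hf (by omega), avg_avg_of_ge hf (by omega),
      avg_avg_of_ge hf (by omega)]
    abel
  · rw [avg_avg_of_le hf (by omega), avg_avg_of_le hf (by omega), avg_avg_of_le hf (by omega),
      avg_avg_of_le hf (by omega)]
    abel

theorem avgDiff_of_symm (hf : (n.factorial : k) ≠ 0) (q : ℕ) {f : MvPolynomial (Fin n) k}
    (h : ∀ σ : Equiv.Perm (Fin n), rename σ f = f) : avgDiff k n q f = 0 := by
  rw [avgDiff, LinearMap.sub_apply, avg_eq_self hf fun σ _ => h σ, avg_eq_self hf fun σ _ => h σ,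
    sub_self]

theorem reynolds_avgDiff (hf : (n.factorial : k) ≠ 0) (q : ℕ) (f : MvPolynomial (Fin n) k) :
    reynolds k n (avgDiff k n q f) = 0 := by
  rw [← avg_zero_eq_reynolds, avgDiff, LinearMap.sub_apply, map_sub,
    avg_avg_of_ge hf (Nat.zero_le _), avg_avg_of_ge hf (Nat.zero_le _), sub_self]

theorem avg_mem {K : Submodule k (MvPolynomial (Fin n) k)}
    (hK : ∀ σ : Equiv.Perm (Fin n), ∀ f ∈ K, rename σ f ∈ K) {f : MvPolynomial (Fin n) k}
    (h : f ∈ K) (q : ℕ) : avg k n q f ∈ K := by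
  rw [avg_apply]
  exact K.smul_mem _ (K.sum_mem fun σ _ => hK σ f h)

theorem avgDiff_mem {K : Submodule k (MvPolynomial (Fin n) k)}
    (hK : ∀ σ : Equiv.Perm (Fin n), ∀ f ∈ K, rename σ f ∈ K) {f : MvPolynomial (Fin n) k}
    (h : f ∈ K) (q : ℕ) : avgDiff k n q f ∈ K :=
  K.sub_mem (avg_mem hK h _) (avg_mem hK h _)

end Average

section Stabilizer

/-- The stabilizer of the class of `x` modulo an invariant subspace. -/
def stabMod (K : Submodule k (MvPolynomial (Fin n) k))
    (hK : ∀ σ : Equiv.Perm (Fin n), ∀ f ∈ K, rename σ f ∈ K) (x : MvPolynomial (Fin n) k) :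
    Subgroup (Equiv.Perm (Fin n)) where
  carrier := {σ | rename σ x - x ∈ K}
  one_mem' := by
    change rename (1 : Equiv.Perm (Fin n)) x - x ∈ K
    rw [rename_one_perm, sub_self]; exact K.zero_mem
  mul_mem' := fun {σ τ} hσ hτ => by
    change rename (σ * τ) x - x ∈ K
    have h := K.add_mem (hK σ _ hτ) hσ
    rwa [map_sub, ← rename_mul_perm, sub_add_sub_cancel] at h
  inv_mem' := fun {σ} hσ => by
    change rename (σ⁻¹ : Equiv.Perm (Fin n)) x - x ∈ K
    have h := K.neg_mem (hK (σ⁻¹ : Equiv.Perm (Fin n)) _ hσ)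
    rwa [map_sub, ← rename_mul_perm, inv_mul_cancel, rename_one_perm, neg_sub] at h

variable {K : Submodule k (MvPolynomial (Fin n) k)}
  {hK : ∀ σ : Equiv.Perm (Fin n), ∀ f ∈ K, rename σ f ∈ K} {x : MvPolynomial (Fin n) k}

theorem mem_stabMod {σ : Equiv.Perm (Fin n)} : σ ∈ stabMod K hK x ↔ rename σ x - x ∈ K := Iff.rfl

theorem conj_mem_stabMod_iff (τ σ : Equiv.Perm (Fin n)) :
    σ ∈ stabMod K hK (rename τ x) ↔ τ⁻¹ * σ * τ ∈ stabMod K hK x := by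
  rw [mem_stabMod, mem_stabMod]
  constructor
  · intro h
    have h1 := hK τ⁻¹ _ h
    rwa [map_sub, ← rename_mul_perm, ← rename_mul_perm, ← rename_mul_perm, inv_mul_cancel,
      rename_one_perm] at h1
  · intro h
    have h1 := hK τ _ h
    rwa [map_sub, ← rename_mul_perm, mul_assoc, mul_inv_cancel_left, rename_mul_perm] at h1

/-- Modulo `K`, `x` equals its average at level `q + 1`, hence its average at level `q`, which is
invariant under the larger group. -/
theorem fixBelow_le_of_avgDiff_mem (hf : (n.factorial : k) ≠ 0) {q : ℕ}
    (h : fixBelow n (q + 1) ≤ stabMod K hK x) (hx : avgDiff k n q x ∈ K) :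
    fixBelow n q ≤ stabMod K hK x := by
  have h1 : avg k n (q + 1) x - x ∈ K := avg_sub_mem hf h
  have h2 : avg k n q x - x ∈ K := by
    have := K.sub_mem h1 hx
    rwa [avgDiff, LinearMap.sub_apply, sub_sub_sub_cancel_left] at this
  intro σ hσ
  have h3 := K.sub_mem h2 (hK σ _ h2)
  rwa [map_sub, rename_avg hσ, sub_sub_sub_cancel_left] at h3

/-- A component at a later level `q'` can serve position `q`: transport `x` by `(q' q)`, enlarge the
stabilizer there so that it contains `(q' t)`, and conjugate back. -/
theorem swap_mem_stabMod (hf : (n.factorial : k) ≠ 0) {q q' t : Fin n} (hqq : q ≤ q')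
    (ht : (t : ℕ) = q' + 1) (h : fixBelow n (q + 1) ≤ stabMod K hK x)
    (hx : avgDiff k n q' (rename (Equiv.swap q' q) x) ∈ K) :
    Equiv.swap q t ∈ stabMod K hK x := by
  have hqq' : (q : ℕ) ≤ q' := hqq
  have h1 : fixBelow n (q' + 1) ≤ stabMod K hK (rename (Equiv.swap q' q) x) := by
    intro σ hσ
    rw [conj_mem_stabMod_iff, mul_assoc, Equiv.mul_swap_eq_swap_mul, hσ q' (by omega),
      hσ q (by omega), inv_mul_cancel_left]
    exact h (fixBelow_anti (by omega) hσ)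
  have h2 := fixBelow_le_of_avgDiff_mem hf h1 hx
    (swap_mem_fixBelow (i := q') (j := t) le_rfl (by omega))
  rw [conj_mem_stabMod_iff, mul_assoc, Equiv.swap_mul_eq_mul_swap, inv_mul_cancel_left,
    Equiv.swap_inv, Equiv.swap_apply_left, Equiv.swap_apply_of_ne_of_ne] at h2
  · exact h2
  · rintro rfl; omega
  · rintro rfl; omega

/-- One transposition joining `q` to a later index suffices: if `σ q ≠ q`, the product `(q t)(t
σq)σ` fixes `q`, and its first two factors lie in `S`. -/
theorem fixBelow_le_of_swap_mem {S : Subgroup (Equiv.Perm (Fin n))} {q t : Fin n} (hqt : q < t)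
    (h : fixBelow n (q + 1) ≤ S) (hs : Equiv.swap q t ∈ S) : fixBelow n q ≤ S := by
  have hqt' : (q : ℕ) < t := hqt
  intro σ hσ
  have key : ∀ ρ ∈ fixBelow n q, ρ q = q → ρ ∈ S := by
    intro ρ hρ hq
    refine h fun i hi => ?_
    rcases Nat.lt_succ_iff_lt_or_eq.1 hi with hi | hi
    · exact hρ i hi
    · rwa [Fin.ext hi]
  by_cases hq : σ q = q
  · exact key σ hσ hq
  · have hlt : (q : ℕ) < σ q := by
      by_contra hcon
      rcases Nat.lt_or_eq_of_le (not_lt.1 hcon) with h1 | h1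
      · exact hq (σ.injective (hσ _ h1))
      · exact hq (Fin.ext h1)
    have h1 : Equiv.swap t (σ q) ∈ S := h (swap_mem_fixBelow (by omega) (by omega))
    have h2 : Equiv.swap q t * Equiv.swap t (σ q) * σ ∈ S := by
      refine key _ ?_ ?_
      · exact mul_mem (mul_mem (swap_mem_fixBelow le_rfl (by omega))
          (swap_mem_fixBelow (by omega) (by omega))) hσ
      · rw [Equiv.Perm.mul_apply, Equiv.Perm.mul_apply, Equiv.swap_apply_right,
          Equiv.swap_apply_right]
    exact (Subgroup.mul_mem_cancel_left S (mul_mem hs h1)).1 h2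

/-- The stabilizer of `x^a` modulo `K` is enlarged one index at a time, from the last to the first.
Equal adjacent exponents supply the required transposition for free, so an element of `K` is needed
only where they differ. -/
theorem rename_monomial_sub_mem (hf : (n.factorial : k) ≠ 0)
    (hK : ∀ σ : Equiv.Perm (Fin n), ∀ f ∈ K, rename σ f ∈ K) (a : Fin n →₀ ℕ)
    (h : ∀ q t : Fin n, (t : ℕ) = q + 1 → a q = a t ∨ ∃ q' t' : Fin n, q ≤ q' ∧
      (t' : ℕ) = q' + 1 ∧ avgDiff k n q' (rename (Equiv.swap q' q) (monomial a 1)) ∈ K)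
    (σ : Equiv.Perm (Fin n)) : rename σ (monomial a (1 : k)) - monomial a 1 ∈ K := by
  have key : ∀ m q : ℕ, q + m + 1 = n → fixBelow n q ≤ stabMod K hK (monomial a 1) := by
    intro m
    induction m with
    | zero =>
      intro q hq σ hσ
      have : σ = 1 := by
        have hlt : ∀ i : Fin n, (i : ℕ) < q → σ i = i := hσ
        have hlast : ∀ i : Fin n, (i : ℕ) = q → σ i = i := by
          intro i hi
          by_contra hne
          have h1 : (σ i : ℕ) < q := by
            have h2 : (σ i : ℕ) ≠ q := fun e => hne (Fin.ext (e.trans hi.symm))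
            omega
          exact hne (σ.injective (hlt _ h1))
        ext i
        rcases Nat.lt_or_ge i q with hi | hi
        · rw [hlt i hi]; rfl
        · rw [hlast i (by omega)]; rfl
      rw [this]
      exact one_mem _
    | succ m ih =>
      intro q hq
      have h1 := ih (q + 1) (by omega)
      have hs := h ⟨q, by omega⟩ ⟨q + 1, by omega⟩ rfl
      rcases hs with heq | ⟨q', t', hqq, ht, hx⟩
      · refine fixBelow_le_of_swap_mem (q := ⟨q, by omega⟩) (t := ⟨q + 1, by omega⟩)
          (Nat.lt_succ_self q) h1 ?_
        rw [mem_stabMod, rename_monomial]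
        have h2 : a.mapDomain (Equiv.swap (⟨q, by omega⟩ : Fin n) ⟨q + 1, by omega⟩) = a := by
          ext i
          rw [mapDomain_perm_apply, Equiv.swap_inv]
          by_cases hi1 : i = ⟨q, by omega⟩
          · rw [hi1, Equiv.swap_apply_left, heq]
          by_cases hi2 : i = ⟨q + 1, by omega⟩
          · rw [hi2, Equiv.swap_apply_right, heq]
          · rw [Equiv.swap_apply_of_ne_of_ne hi1 hi2]
        rw [h2, sub_self]
        exact K.zero_mem
      · have hqq' : q ≤ q' := hqq
        refine fixBelow_le_of_swap_mem (q := ⟨q, by omega⟩) (t := t') ?_ h1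
          (swap_mem_stabMod hf hqq ht h1 hx)
        change q < (t' : ℕ)
        omega
  have hn : 0 < n ∨ n = 0 := by omega
  rcases hn with hn | rfl
  · have h1 := key (n - 1) 0 (by omega)
    rw [fixBelow_zero] at h1
    exact h1 (Subgroup.mem_top σ)
  · rw [Subsingleton.elim σ 1, rename_one_perm, sub_self]
    exact K.zero_mem

end Stabilizer
end SymIdeal

end

/-! ### Allocation of descents and nonemptiness of `O` -/

noncomputable section

namespace SymIdeal

variable {k : Type*} [Field k] {n d r : ℕ}

section Allocation

/-- The descents of the sorted exponent vectors of degree `d`: pairs of such a vector `a` and a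
position `q` with `a q > a (q + 1)`. -/
abbrev Descent (n d : ℕ) : Type :=
  {x : SortedExp n d × Fin n // ∃ t : Fin n, (t : ℕ) = x.2 + 1 ∧ x.1.1 t < x.1.1 x.2}

instance (n d : ℕ) : Fintype (Descent n d) := Fintype.ofFinite _

/-- At a descent in position `q`, subtracting `1` from entries `0, …, q` keeps the vector sorted,
lowers the degree by `q + 1`, and is injective. -/
theorem card_descent_le (hdn : d ≤ n) (q : ℕ) :
    Nat.card {x : Descent n d // (x.1.2 : ℕ) = q} ≤ if q < d then P (d - 1 - q) else 0 := by
  classical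
  let lower : (Fin n →₀ ℕ) → (Fin n →₀ ℕ) := fun a =>
    Finsupp.equivFunOnFinite.symm fun i => if (i : ℕ) ≤ q then a i - 1 else a i
  have hlower : ∀ a i, lower a i = if (i : ℕ) ≤ q then a i - 1 else a i := fun _ _ => rfl
  have hpos : ∀ x : {x : Descent n d // (x.1.2 : ℕ) = q}, ∀ i : Fin n, (i : ℕ) ≤ q →
      1 ≤ x.1.1.1.1 i := by
    rintro ⟨⟨⟨a, p⟩, t, ht, hlt⟩, hq⟩ i hi
    have h1 : a.1 p ≤ a.1 i := a.2.1 (Fin.le_def.2 (hi.trans_eq hq.symm))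
    change a.1 t < a.1 p at hlt
    change 1 ≤ a.1 i
    omega
  have hdeg : ∀ x : {x : Descent n d // (x.1.2 : ℕ) = q},
      (lower x.1.1.1.1).degree + (q + 1) = d := by
    intro x
    refine Eq.trans ?_ x.1.1.1.2.2
    have h1 : ∀ i : Fin n, x.1.1.1.1 i = lower x.1.1.1.1 i + if (i : ℕ) ≤ q then 1 else 0 := by
      intro i
      have := hpos x i
      rw [hlower]
      split_ifs with h
      · have := this h; omega
      · rfl
    have h2 : (Finset.univ.filter fun i : Fin n => (i : ℕ) ≤ q).card = q + 1 := by
      have h3 : (Finset.univ.filter fun i : Fin n => (i : ℕ) ≤ q) = Finset.Iic x.1.1.2 := by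
        ext i
        rw [Finset.mem_filter, Finset.mem_Iic, Fin.le_def, x.2]
        exact and_iff_right (Finset.mem_univ i)
      rw [h3, Fin.card_Iic, x.2]
    rw [Finsupp.degree_eq_sum, Finsupp.degree_eq_sum,
      Finset.sum_congr rfl fun i _ => h1 i, Finset.sum_add_distrib, Finset.sum_boole, h2]
    rfl
  have hanti : ∀ x : {x : Descent n d // (x.1.2 : ℕ) = q}, Antitone (lower x.1.1.1.1) := by
    rintro ⟨⟨⟨a, p⟩, t, ht, hlt⟩, hq⟩ i j hij
    have h1 := a.2.1 hij
    have hij' : (i : ℕ) ≤ j := hij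
    change a.1 t < a.1 p at hlt
    change (t : ℕ) = p + 1 at ht
    change (p : ℕ) = q at hq
    change lower a.1 j ≤ lower a.1 i
    rw [hlower, hlower]
    split_ifs with hj hi hi
    · omega
    · omega
    · have h2 : a.1 p ≤ a.1 i := a.2.1 (show (i : ℕ) ≤ p by omega)
      have h3 : a.1 j ≤ a.1 t := a.2.1 (show (t : ℕ) ≤ j by omega)
      omega
    · exact h1
  split_ifs with hqd
  · rw [← card_sortedExp (n := n) (by omega), ← Nat.card_eq_fintype_card]
    refine Nat.card_le_card_of_injective
      (fun x => (⟨lower x.1.1.1.1, hanti x, by have := hdeg x; omega⟩ :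
        SortedExp n (d - 1 - q))) ?_
    intro x y hxy
    have h1 : lower x.1.1.1.1 = lower y.1.1.1.1 := congrArg Subtype.val hxy
    have h2 : x.1.1.1.1 = y.1.1.1.1 := by
      ext i
      have h3 := DFunLike.congr_fun h1 i
      rw [hlower, hlower] at h3
      by_cases hi : (i : ℕ) ≤ q
      · rw [if_pos hi, if_pos hi] at h3
        have := hpos x i hi
        have := hpos y i hi
        omega
      · rwa [if_neg hi, if_neg hi] at h3
    exact Subtype.ext (Subtype.ext (Prod.ext (Subtype.ext h2) (Fin.ext (x.2.trans y.2.symm))))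
  · have : IsEmpty {x : Descent n d // (x.1.2 : ℕ) = q} := by
      refine ⟨fun x => ?_⟩
      have := hdeg x
      omega
    rw [Nat.card_of_isEmpty]

/-- Either all remaining terms are at most `r`, and `d - m ≤ n - 1 - m` of them are summed; or, `P`
being monotone, each of the `m` omitted terms is at least `r`, and removing them from the hypothesis
suffices. -/
theorem sum_partitions_le (hdn : d < n) (h : ∑ i ∈ Finset.range d, P i ≤ r * (n - 1)) (m : ℕ) :
    ∑ i ∈ Finset.range (d - m), P i ≤ r * (n - 1 - m) := by
  rcases le_total d m with hm | hm
  · rw [Nat.sub_eq_zero_of_le hm]; simp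
  by_cases hall : ∀ i ∈ Finset.range (d - m), P i ≤ r
  · refine (Finset.sum_le_card_nsmul _ _ _ hall).trans ?_
    rw [Finset.card_range, smul_eq_mul, mul_comm]
    exact Nat.mul_le_mul_left r (by omega)
  · push Not at hall
    obtain ⟨i, hi, hri⟩ := hall
    rw [Finset.mem_range] at hi
    have h1 := Finset.sum_range_add P (d - m) m
    rw [Nat.sub_add_cancel hm] at h1
    have h2 : m * r ≤ ∑ j ∈ Finset.range m, P (d - m + j) := by
      have := Finset.card_nsmul_le_sum (Finset.range m) (fun j => P (d - m + j)) r
        fun j _ => hri.le.trans (P_mono (by omega))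
      rwa [Finset.card_range, smul_eq_mul] at this
    have h3 : r * (n - 1) = r * (n - 1 - m) + m * r := by
      rw [mul_comm m r, ← mul_add]
      congr 1
      omega
    omega

theorem card_descent_ge_le (hdn : d < n) (h : ∑ i ∈ Finset.range d, P i ≤ r * (n - 1)) (m : ℕ) :
    (Finset.univ.filter fun x : Descent n d => m ≤ (x.1.2 : ℕ)).card ≤ r * (n - 1 - m) := by
  classical
  refine le_trans ?_ (sum_partitions_le hdn h m)
  have hcard : ∀ q, (Finset.univ.filter fun x : Descent n d => (x.1.2 : ℕ) = q).card ≤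
      if q < d then P (d - 1 - q) else 0 := by
    intro q
    refine le_trans (le_of_eq ?_) (card_descent_le hdn.le q)
    rw [Nat.card_eq_fintype_card, Fintype.card_subtype]
  have hsub : (Finset.univ.filter fun x : Descent n d => m ≤ (x.1.2 : ℕ)) ⊆
      (Finset.range (d - m)).biUnion fun i =>
        Finset.univ.filter fun x : Descent n d => (x.1.2 : ℕ) = d - 1 - i := by
    intro x hx
    rw [Finset.mem_filter] at hx
    have hlt : (x.1.2 : ℕ) < d := by
      by_contra hcon
      have h1 := hcard x.1.2
      rw [if_neg hcon, Nat.le_zero, Finset.card_eq_zero, Finset.filter_eq_empty_iff] at h1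
      exact h1 (Finset.mem_univ x) rfl
    rw [Finset.mem_biUnion]
    refine ⟨d - 1 - x.1.2, Finset.mem_range.2 (by omega), ?_⟩
    rw [Finset.mem_filter]
    exact ⟨Finset.mem_univ x, by omega⟩
  refine (Finset.card_le_card hsub).trans (Finset.card_biUnion_le.trans ?_)
  refine Finset.sum_le_sum fun i hi => (hcard _).trans ?_
  rw [Finset.mem_range] at hi
  rw [if_pos (by omega), show d - 1 - (d - 1 - i) = i by omega]

/-- The slots open to a descent depend only on its position and shrink as it grows. Hall's condition
for a set of descents thus reduces to counting all descents from its least position onwards. -/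
theorem exists_allocation (hdn : d < n) (h : ∑ i ∈ Finset.range d, P i ≤ r * (n - 1)) :
    ∃ F : Descent n d → Fin (n - 1) × Fin r, Function.Injective F ∧
      ∀ x, (x.1.2 : ℕ) ≤ (F x).1 := by
  classical
  let t : Descent n d → Finset (Fin (n - 1) × Fin r) := fun x =>
    Finset.univ.filter fun s => (x.1.2 : ℕ) ≤ s.1
  have ht : ∀ x, r * (n - 1 - x.1.2) ≤ (t x).card := by
    intro x
    have h1 : t x = (Finset.univ.filter fun s : Fin (n - 1) => (x.1.2 : ℕ) ≤ s) ×ˢ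
        Finset.univ := by
      ext s
      simp [t]
    have h2 : n - 1 - x.1.2 ≤
        (Finset.univ.filter fun s : Fin (n - 1) => (x.1.2 : ℕ) ≤ s).card := by
      have hinj := Finset.card_le_card_of_injOn (s := (Finset.univ : Finset (Fin (n - 1 - x.1.2))))
        (t := Finset.univ.filter fun s : Fin (n - 1) => (x.1.2 : ℕ) ≤ s)
        (fun i => ⟨x.1.2 + i, by omega⟩)
        (fun i _ => by simp)
        (fun i _ j _ hij => by
          have := congrArg Fin.val hij
          exact Fin.ext (by simpa using this))
      simpa using hinj
    rw [h1, Finset.card_product, Finset.card_univ, Fintype.card_fin, mul_comm]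
    exact Nat.mul_le_mul_right r h2
  obtain ⟨F, hF, hFt⟩ := (Finset.all_card_le_biUnion_card_iff_exists_injective t).1 (by
    intro A
    rcases A.eq_empty_or_nonempty with rfl | hA
    · simp
    obtain ⟨x, hxA, hx⟩ := A.exists_min_image (fun x => (x.1.2 : ℕ)) hA
    calc A.card ≤ (Finset.univ.filter fun y : Descent n d => (x.1.2 : ℕ) ≤ (y.1.2 : ℕ)).card :=
          Finset.card_le_card fun y hy => Finset.mem_filter.2 ⟨Finset.mem_univ y, hx y hy⟩
      _ ≤ r * (n - 1 - x.1.2) := card_descent_ge_le hdn h _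
      _ ≤ (t x).card := ht x
      _ ≤ (A.biUnion t).card := Finset.card_le_card (Finset.subset_biUnion_of_mem t hxA))
  exact ⟨F, hF, fun x => (Finset.mem_filter.1 (hFt x)).2⟩

end Allocation

/-- The generators are a spanning family of `U` plus components killed by `ρ`, one for each slot
`(q, j)`; each component is recovered inside the orbit span by its idempotent. -/
theorem exists_generators (hf : (n.factorial : k) ≠ 0) (hdn : d < n)
    (hsum : ∑ i ∈ Finset.range d, P i ≤ r * (n - 1))
    {U : Submodule k (MvPolynomial (Fin n) k)} (hU : U ≤ invForms k n d)
    (hUr : Module.finrank k U ≤ r) :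
    ∃ V ≤ forms k n d, Module.finrank k V ≤ r ∧ alpha V = U ∧
      forms k n d ⊓ LinearMap.ker (reynolds k n) ≤ orbitSpan V := by
  classical
  have hUfd : FiniteDimensional k U := Submodule.finiteDimensional_of_le hU
  obtain ⟨h, hh⟩ := exists_fun_span_eq U hUr
  have hinv : ∀ j, h j ∈ invForms k n d := fun j =>
    hU (hh ▸ Submodule.subset_span (Set.mem_range_self j))
  obtain ⟨F, hF, hFle⟩ := exists_allocation hdn hsum
  have hlt : ∀ q : Fin (n - 1), (q : ℕ) < n := fun q => by omega
  -- The slot of a descent holds its monomial, transported from its position to the level of the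
  -- slot; unused slots hold `0`.
  let g : Fin (n - 1) × Fin r → MvPolynomial (Fin n) k :=
    Function.extend F (fun x => rename (Equiv.swap ⟨(F x).1, hlt _⟩ x.1.2)
      (monomial x.1.1.1 (1 : k))) 0
  have hgF : ∀ x, g (F x) = rename (Equiv.swap ⟨(F x).1, hlt _⟩ x.1.2)
      (monomial x.1.1.1 (1 : k)) := fun x => hF.extend_apply _ _ x
  have hg : ∀ s, g s ∈ forms k n d := by
    intro s
    by_cases hs : ∃ x, F x = s
    · obtain ⟨x, rfl⟩ := hs
      rw [hgF]
      exact rename_mem_forms (isHomogeneous_monomial _ x.1.1.2.2) _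
    · have : g s = 0 := Function.extend_apply' _ _ _ hs
      rw [this]
      exact Submodule.zero_mem _
  let f : Fin r → MvPolynomial (Fin n) k := fun j =>
    h j + ∑ q : Fin (n - 1), avgDiff k n q (g (q, j))
  have hfrey : ∀ j, reynolds k n (f j) = h j := by
    intro j
    simp only [f]
    rw [map_add, map_sum, Finset.sum_eq_zero, add_zero, reynolds_eq_self hf (hinv j)]
    exact fun q _ => reynolds_avgDiff hf q _
  have hfavg : ∀ (q : Fin (n - 1)) j, avgDiff k n q (f j) = avgDiff k n q (g (q, j)) := by
    intro q j
    simp only [f]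
    rw [map_add, map_sum, avgDiff_of_symm hf q (mem_invForms.1 (hinv j)).1, zero_add,
      Finset.sum_eq_single q, avgDiff_avgDiff hf]
    · intro q' _ hne
      exact avgDiff_avgDiff_of_ne hf (fun e => hne (Fin.ext e.symm)) _
    · intro hq
      exact absurd (Finset.mem_univ q) hq
  have hforms : ∀ j, f j ∈ forms k n d := fun j =>
    Submodule.add_mem _ (invForms_le_forms _ _ _ (hinv j)) (Submodule.sum_mem _ fun q _ =>
      avgDiff_mem (fun σ _ h => rename_mem_forms h σ) (hg _) _)
  refine ⟨Submodule.span k (Set.range f), ?_, ?_, ?_, ?_⟩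
  · refine Submodule.span_le.2 ?_
    rintro _ ⟨j, rfl⟩
    exact hforms j
  · exact (finrank_range_le_card f).trans_eq (Fintype.card_fin r)
  · rw [alpha_span, ← hh]
    simp only [hfrey]
  · set K := orbitSpan (Submodule.span k (Set.range f)) with hKdef
    have hK : ∀ σ : Equiv.Perm (Fin n), ∀ f ∈ K, rename σ f ∈ K :=
      fun σ _ h => rename_mem_orbitSpan_of_mem h σ
    have hfK : ∀ j, f j ∈ K := fun j => by
      have := rename_mem_orbitSpan (Submodule.subset_span (Set.mem_range_self j) :
        f j ∈ Submodule.span k (Set.range f)) 1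
      rwa [rename_one_perm] at this
    have hgK : ∀ x : Descent n d, avgDiff k n (F x).1 (g (F x)) ∈ K := fun x => by
      have := avgDiff_mem hK (hfK (F x).2) (F x).1
      rwa [hfavg] at this
    have hsorted : ∀ (a : SortedExp n d) (σ : Equiv.Perm (Fin n)),
        rename σ (monomial a.1 (1 : k)) - monomial a.1 1 ∈ K := by
      intro a σ
      refine rename_monomial_sub_mem hf hK a.1 (fun q t ht => ?_) σ
      rcases (a.2.1 (show q ≤ t from by rw [Fin.le_def]; omega)).eq_or_lt with heq | hlt'
      · exact Or.inl heq.symm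
      · right
        let x : Descent n d := ⟨(a, q), t, ht, hlt'⟩
        refine ⟨⟨(F x).1, hlt _⟩, ⟨(F x).1 + 1, by omega⟩, hFle x, rfl, ?_⟩
        have h1 := hgK x
        rwa [hgF] at h1
    -- These differences span `R_d ∩ ker ρ`, since every `p` in that kernel equals `p - ρ(p)`.
    have hmon : ∀ b : DegExp n d, monomial b.1 (1 : k) - reynolds k n (monomial b.1 1) ∈ K := by
      intro b
      obtain ⟨σ, hσ⟩ := exists_mapDomain_sortExp b.1 b.2
      have h1 : rename σ (monomial b.1 (1 : k)) = monomial (sortExp b.1 b.2).1 1 := by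
        rw [rename_monomial, hσ]
      have h2 : monomial b.1 (1 : k) = rename (σ⁻¹ : Equiv.Perm (Fin n))
          (monomial (sortExp b.1 b.2).1 1) := by
        rw [← h1, ← rename_mul_perm, inv_mul_cancel, rename_one_perm]
      have h3 := hsorted (sortExp b.1 b.2) σ⁻¹
      rw [← h2] at h3
      have h4 : avg k n 0 (monomial (sortExp b.1 b.2).1 (1 : k)) -
          monomial (sortExp b.1 b.2).1 1 ∈ K := avg_sub_mem hf fun τ _ => hsorted _ τ
      rw [avg_zero_eq_reynolds] at h4
      have h5 := K.sub_mem h3 h4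
      rwa [sub_sub_sub_cancel_right, ← h1, reynolds_rename] at h5
    rintro p ⟨hp, hp0⟩
    have h1 : p = ∑ b : DegExp n d, coeff b.1 p •
        (monomial b.1 (1 : k) - reynolds k n (monomial b.1 1)) := by
      have h2 : reynolds k n p = ∑ b : DegExp n d, coeff b.1 p • reynolds k n (monomial b.1 1) := by
        conv_lhs => rw [form_eq_sum hp]
        rw [map_sum]
        exact Finset.sum_congr rfl fun b _ => map_smul _ _ _
      simp only [smul_sub]
      rw [Finset.sum_sub_distrib, ← form_eq_sum hp, ← h2, LinearMap.mem_ker.1 hp0, sub_zero]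
    rw [h1]
    exact K.sum_mem fun b _ => K.smul_mem _ (hmon b)

theorem alpha_le_map_orbitSpan (V : Submodule k (MvPolynomial (Fin n) k)) :
    alpha V ≤ (orbitSpan V).map (reynolds k n) :=
  Submodule.map_mono fun f hf => by
    have := rename_mem_orbitSpan hf 1
    rwa [rename_one_perm] at this

theorem mem_OTilde_of_le (hf : (n.factorial : k) ≠ 0) (hdn : d ≤ n)
    {V : Submodule k (MvPolynomial (Fin n) k)} (hV : V ∈ Gr r (forms k n d))
    (hker : forms k n d ⊓ LinearMap.ker (reynolds k n) ≤ orbitSpan V)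
    (hα : min r (P d) ≤ Module.finrank k (alpha V)) : V ∈ OTilde k n r d := by
  refine mem_OTilde_iff.2 ⟨hV, ?_⟩
  have := Submodule.finiteDimensional_of_le (orbitSpan_le_forms hV.1)
  have h1 := finrank_map_add_finrank_inf_ker (reynolds k n) (orbitSpan V)
  have h2 := Submodule.finrank_mono (alpha_le_map_orbitSpan V)
  have : FiniteDimensional k ↥(orbitSpan V ⊓ LinearMap.ker (reynolds k n)) :=
    Submodule.finiteDimensional_of_le inf_le_left
  have h3 := Submodule.finrank_mono (le_inf hker
    (inf_le_right : forms k n d ⊓ LinearMap.ker (reynolds k n) ≤ _))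
  have h4 := finrank_forms_inf_ker hf hdn (k := k)
  omega

theorem O_nonempty (hf : (n.factorial : k) ≠ 0) (hr : 0 < r) (hd : 0 < d) (hdn : d < n)
    (hsum : ∑ i ∈ Finset.range d, P i ≤ r * (n - 1)) (hrd : r ≤ (n + d - 1).choose d) :
    (O k n r d).Nonempty := by
  rcases lt_or_ge r (P d) with hrP | hrP
  · obtain ⟨U, hU⟩ := G_nonempty (k := k) hf hr hd hdn hrP.le
    obtain ⟨V, hV, hVr, hα, hker⟩ := exists_generators hf hdn hsum hU.1.1 hU.1.2.le
    have hfd : FiniteDimensional k V := Submodule.finiteDimensional_of_le hV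
    have hVr' : r ≤ Module.finrank k V := by
      rw [← hU.1.2, ← hα]
      exact Submodule.finrank_map_le _ _
    refine ⟨V, mem_OTilde_of_le hf hdn.le ⟨hV, hVr.antisymm hVr'⟩ hker ?_, fun _ => hα ▸ hU⟩
    rw [hα, hU.1.2]
    exact min_le_left _ _
  -- Here `U` is all of `R'_d`. The resulting space may have dimension below `r`, and is enlarged
  -- inside `R_d`, which preserves both properties.
  · obtain ⟨V₀, hV₀, hVr, hα, hker⟩ := exists_generators (k := k) hf hdn hsum
      (le_refl (invForms k n d)) (by rwa [finrank_invForms hdn.le])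
    have h1 : Module.finrank k (V₀.submoduleOf (forms k n d)) ≤ r := by
      rwa [(Submodule.submoduleOfEquivOfLe hV₀).finrank_eq]
    obtain ⟨W, hW, -, hWr⟩ := exists_between_finrank_eq (le_top (a := V₀.submoduleOf _)) h1
      (by rw [finrank_top]; exact hrd.trans finrank_forms)
    have hV₀W : V₀ ≤ W.map (forms k n d).subtype := fun f hf' =>
      ⟨⟨f, hV₀ hf'⟩, hW hf', rfl⟩
    have hWG : W.map (forms k n d).subtype ∈ Gr r (forms k n d) := by
      refine ⟨Submodule.map_subtype_le _ _, ?_⟩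
      rw [← hWr]
      exact (Submodule.equivMapOfInjective _ (Submodule.subtype_injective _) W).finrank_eq.symm
    refine ⟨_, mem_OTilde_of_le hf hdn.le hWG (hker.trans (Submodule.span_mono ?_)) ?_,
      fun h => absurd h (not_lt.2 hrP)⟩
    · rintro _ ⟨σ, f, hf', rfl⟩
      exact ⟨σ, f, hV₀W hf', rfl⟩
    · have h2 : invForms k n d ≤ alpha (W.map (forms k n d).subtype) := by
        rw [← hα]
        exact Submodule.map_mono hV₀W
      have : FiniteDimensional k (alpha (W.map (forms k n d).subtype)) :=
        Submodule.finiteDimensional_of_le (alpha_le_invForms hWG.1)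
      rw [← finrank_invForms (k := k) hdn.le]
      exact (min_le_right _ _).trans (Submodule.finrank_mono h2)

end SymIdeal

end

theorem mainTheorem3 (k : Type*) [Field k] [Infinite k] (n r d : ℕ)
    (hchar : ringChar k = 0 ∨ n < ringChar k) (hr : 0 < r) (hd : 0 < d)
    (hn : max ((d : ℚ) + 1) (1 + 1 / (r : ℚ) * ∑ i ∈ Finset.range d, (SymIdeal.P i : ℚ)) ≤ n) :
    SymIdeal.IsZariskiOpen r (SymIdeal.forms k n d) (SymIdeal.O k n r d) ∧
    (r ≤ (n + d - 1).choose d → (SymIdeal.O k n r d).Nonempty) ∧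
    ∀ I J : Ideal (MvPolynomial (Fin n) k),
      SymIdeal.IsGeneralSymmetricIdeal r d I → SymIdeal.IsSymmetricIdeal r d J →
        ∀ i : ℕ, SymIdeal.hilbertFunction I i ≤ SymIdeal.hilbertFunction J i := by
  have hf := SymIdeal.factorial_ne_zero_of_char hchar
  have hdn : d < n := by
    have h1 := (le_max_left _ _).trans hn
    exact_mod_cast h1
  -- Clearing the denominator `r` turns the numerical hypothesis into the slot count.
  have hsum : ∑ i ∈ Finset.range d, SymIdeal.P i ≤ r * (n - 1) := by
    have h1 := (le_max_right _ _).trans hn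
    have hr' : (0 : ℚ) < r := by exact_mod_cast hr
    have h2 : 1 / (r : ℚ) * ∑ i ∈ Finset.range d, (SymIdeal.P i : ℚ) ≤ ((n - 1 : ℕ) : ℚ) := by
      rw [Nat.cast_sub (by omega), Nat.cast_one]
      linarith
    rw [one_div, inv_mul_le_iff₀ hr'] at h2
    exact_mod_cast h2
  refine ⟨SymIdeal.isZariskiOpen_O hf hd hdn, SymIdeal.O_nonempty hf hr hd hdn hsum, ?_⟩
  rintro _ _ ⟨V, hV, rfl⟩ ⟨V', hV', rfl⟩ i
  exact SymIdeal.hilbertFunction_le hf hr hd hdn hV hV' i
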